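/- **Theorem.** Let $(a_{ij})\in\mathbb{Z}^{n\times m}$ be such that for each $i=1,\dots,n$ the integers $a_{i1},\dots,a_{im}$ are relatively prime (i.e. $\gcd(a_{i1},\dots,a_{im})=1$), and let $\alpha_1,\dots,\alpha_n\in\mathbb{R}$ satisfy $\sum_{i=1}^n\alpha_i=0$. Suppose that for every finite cyclic group $G$ and all independent $G$-valued random variables $Z_1,\dots,Z_m$, $$\sum_{i=1}^n \alpha_i\, H\Big(\sum_{j=1}^m a_{ij}Z_j\Big)\le 0,$$ where $H(Z)=\sum_x \mathbb{P}(Z=x)\log\frac{1}{\mathbb{P}(Z=x)}$ is the Shannon entropy. Let $d\ge 0$, let $\mathbb{T}$ be the unit circle in $\mathbb{C}$, and equip the torus $\mathbb{T}^d$ with the Haar measure $\mu$ that is the pushforward of Lebesgue measure on $[0,1)^d$ under $(\theta_1,\dots,\theta_d)\mapsto(e^{2\pi i\theta_1},\dots,e^{2\pi i\theta_d})$. For a random variable $X$ with density $f$ with respect to $\mu$, let $h(X)=\int_{\mathbb{T}^d} f\log\frac1f\,d\mu$. Then for all independent $\mathbb{T}^d$-valued random variables $X_1,\dots,X_m$,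 each having a law that is absolutely continuous with respect to $\mu$, such that the differential entropies $h\big(\sum_{j=1}^m a_{ij}X_j\big)$, $i=1,\dots,n$, exist and are finite (the group $\mathbb{T}^d$ being written additively, so that $\sum_j a_{ij}X_j$ is the coordinatewise product $\prod_j X_j^{a_{ij}}$), $$\sum_{i=1}^n \alpha_i\, h\Big(\sum_{j=1}^m a_{ij}X_j\Big)\le 0.$$ -/

import Mathlib

open MeasureTheory ProbabilityTheory

noncomputable section

/-- Shannon entropy `H(Z) = ∑ₓ P(Z = x) log (1 / P(Z = x))` of a random variable with values in
a finite set (`Real.negMulLog t = -t * log t`, with value `0` at `t = 0`). -/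
def shannonEntropy {Ω G : Type*} [MeasurableSpace Ω] [Fintype G]
    (P : Measure Ω) (Z : Ω → G) : ℝ :=
  ∑ x : G, Real.negMulLog (P.real (Z ⁻¹' {x}))

/-- The density of (the law of) `X` with respect to the reference measure `ν`. -/
def density {Ω S : Type*} [MeasurableSpace Ω] [MeasurableSpace S]
    (P : Measure Ω) (ν : Measure S) (X : Ω → S) (x : S) : ℝ :=
  ((P.map X).rnDeriv ν x).toReal

/-- Differential entropy `h(X) = ∫ f log (1 / f) dν`, where `f` is the density of `X` with
respect to `ν`. It is meaningful when `FiniteDiffEntropy P ν X` holds. -/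
def diffEntropy {Ω S : Type*} [MeasurableSpace Ω] [MeasurableSpace S]
    (P : Measure Ω) (ν : Measure S) (X : Ω → S) : ℝ :=
  ∫ x, Real.negMulLog (density P ν X x) ∂ν

/-- The differential entropy of `X` with respect to `ν` exists and is finite: `X` has a density
`f` with respect to `ν`, and `f log (1 / f)` is integrable. -/
def FiniteDiffEntropy {Ω S : Type*} [MeasurableSpace Ω] [MeasurableSpace S]
    (P : Measure Ω) (ν : Measure S) (X : Ω → S) : Prop :=
  P.map X ≪ ν ∧ Integrable (fun x => Real.negMulLog (density P ν X x)) ν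

/-- The unit circle carries its Borel `σ`-algebra. -/
instance circleMeasurableSpace : MeasurableSpace Circle := borel Circle

instance circleBorelSpace : BorelSpace Circle := ⟨rfl⟩

/-- The torus `𝕋ᵈ`, where `𝕋` is the unit circle in `ℂ` (a group under multiplication),
with its product (Borel) measurable structure. -/
abbrev Torus (d : ℕ) : Type := Fin d → Circle

/-- The angular parametrization `(θ₁, …, θ_d) ↦ (exp (2πiθ₁), …, exp (2πiθ_d))`. -/
def angleMap (d : ℕ) (θ : Fin d → ℝ) : Torus d :=
  fun l => Circle.exp (2 * Real.pi * θ l)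

/-- The Haar measure on `𝕋ᵈ` of total mass one: the pushforward of Lebesgue measure on `[0,1)ᵈ`
under the angular parametrization. -/
def torusHaar (d : ℕ) : Measure (Torus d) :=
  ((volume : Measure (Fin d → ℝ)).restrict
    (Set.pi Set.univ fun _ => Set.Ico (0 : ℝ) 1)).map (angleMap d)

end

/-!
The statement transfers an entropy inequality from finite cyclic groups to the torus without any
approximation at the level of sums, because for trigonometric polynomial densities the
discretisation is exact.

Let `X₁, …, X_m` be independent with densities that are trigonometric polynomials of degree at most
`D`. The density of `∏ⱼ Xⱼ ^ aⱼ` is the trigonometric polynomial `g` whose `k`-th coefficient is the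
product of the `aⱼ k`-th coefficients of the factors. Embed a cyclic group `ℤ/M` in the torus so that
no character of small nonzero frequency becomes trivial on it, and let `Zⱼ` be independent on `ℤ/M`
with the law proportional to the `j`-th density. Bézout's identity for the coprime `aⱼ` excludes
aliasing (`prod_sum_dualFreq_eq`), so that the law of `∑ⱼ aⱼ Zⱼ` is exactly `g / M`
(`sum_prod_trigPoly_eq`). Its entropy is `log M` plus a Riemann sum of `-g log g`; the terms `log M`
cancel because `∑ αᵢ = 0`, and the Riemann sums converge to integrals by equidistribution
(`tendsto_average_cyclicEmb`). This gives the inequality for trigonometric polynomial densities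
(`CyclicEntropyIneq.integral_le`).

In general, multiply each `Xⱼ` by an independent variable with a Fejér kernel as density. The new
density is a trigonometric polynomial, and the density `gᵢ` of `∏ⱼ Xⱼ ^ aᵢⱼ` is convolved with a
nonnegative trigonometric kernel whose Fourier coefficients tend to one
(`trigPoly_combCoeff_smoothedCoeff`). The convolutions converge to `gᵢ` in `L¹`, their entropies are
at least that of `gᵢ` by Jensen's inequality, and the limit superior of their entropies is at most
that of `gᵢ` by Fatou's lemma. Hence the entropies converge
(`tendsto_integral_negMulLog_trigConv`) and the inequality passes to the limit.
-/

open Filter Topology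
open scoped ComplexOrder

/-! ### Characters and trigonometric polynomials on the torus -/

/-- The character `x ↦ ∏ₗ xₗ ^ kₗ` of the torus attached to the frequency `k ∈ ℤᵈ`, as a
complex-valued function. -/
noncomputable def torusChar {d : ℕ} (k : Fin d → ℤ) (x : Torus d) : ℂ :=
  ((∏ l, x l ^ k l : Circle) : ℂ)

namespace torusChar

variable {d : ℕ} (k k' : Fin d → ℤ) (x y : Torus d)

lemma map_mul : torusChar k (x * y) = torusChar k x * torusChar k y := by
  simp [torusChar, mul_zpow, Finset.prod_mul_distrib]

lemma map_one : torusChar k (1 : Torus d) = 1 := by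
  simp [torusChar]

lemma map_inv : torusChar k x⁻¹ = torusChar (-k) x := by
  simp [torusChar]

lemma map_zpow (a : ℤ) : torusChar k (x ^ a) = torusChar (a • k) x := by
  simp only [torusChar, Pi.pow_apply, Pi.smul_apply, smul_eq_mul, zpow_mul]

lemma map_div : torusChar k (x / y) = torusChar k x * torusChar (-k) y := by
  rw [div_eq_mul_inv, map_mul, map_inv]

lemma map_prod {m : ℕ} (z : Fin m → Torus d) :
    torusChar k (∏ j, z j) = ∏ j, torusChar k (z j) :=
  _root_.map_prod ({ toFun := torusChar k, map_one' := map_one k, map_mul' := map_mul k } :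
    Torus d →* ℂ) z Finset.univ

lemma freq_zero : torusChar 0 x = 1 := by
  simp [torusChar]

lemma freq_add : torusChar (k + k') x = torusChar k x * torusChar k' x := by
  simp [torusChar, zpow_add, Finset.prod_mul_distrib]

lemma freq_neg : torusChar (-k) x = star (torusChar k x) := by
  simp [torusChar, ← Circle.coe_inv_eq_conj]

lemma norm_eq_one : ‖torusChar k x‖ = 1 :=
  Circle.norm_coe _

lemma continuous : Continuous (torusChar k) := by
  unfold torusChar; fun_prop

end torusChar

/-- The cube of frequencies `k ∈ ℤᵈ` with `|kₗ| ≤ D` for all `l`. -/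
noncomputable def freqBox (d D : ℕ) : Finset (Fin d → ℤ) :=
  Fintype.piFinset fun _ => Finset.Icc (-(D : ℤ)) D

lemma mem_freqBox {d D : ℕ} {k : Fin d → ℤ} : k ∈ freqBox d D ↔ ∀ l, |k l| ≤ D := by
  simp [freqBox, abs_le]

lemma zero_mem_freqBox (d D : ℕ) : (0 : Fin d → ℤ) ∈ freqBox d D := by
  simp [mem_freqBox]

/-- The trigonometric polynomial of degree at most `D` with coefficients `c`; the values of `c`
outside `freqBox d D` are ignored. -/
noncomputable def trigPoly {d : ℕ} (D : ℕ) (c : (Fin d → ℤ) → ℂ) (x : Torus d) : ℂ :=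
  ∑ k ∈ freqBox d D, c k * torusChar k x

lemma continuous_trigPoly {d : ℕ} (D : ℕ) (c : (Fin d → ℤ) → ℂ) : Continuous (trigPoly D c) := by
  unfold trigPoly
  exact continuous_finsetSum _ fun k _ => continuous_const.mul (torusChar.continuous k)

/-! ### Haar measure on the torus -/

lemma measurable_angleMap (d : ℕ) : Measurable (angleMap d) := by
  unfold angleMap
  have : Continuous fun θ : Fin d → ℝ =>
      (fun l => Circle.exp (2 * Real.pi * θ l) : Torus d) := by
    fun_prop
  exact this.measurable

lemma torusHaar_eq_map_pi (d : ℕ) : torusHaar d =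
    (Measure.pi fun _ : Fin d => (volume : Measure ℝ).restrict (Set.Ico 0 1)).map (angleMap d) := by
  rw [torusHaar, volume_pi, Measure.restrict_pi_pi]

instance isProbabilityMeasure_restrict_Ico :
    IsProbabilityMeasure ((volume : Measure ℝ).restrict (Set.Ico 0 1)) := ⟨by simp⟩

instance isProbabilityMeasure_torusHaar (d : ℕ) : IsProbabilityMeasure (torusHaar d) := by
  rw [torusHaar_eq_map_pi]
  exact Measure.isProbabilityMeasure_map (measurable_angleMap d).aemeasurable

lemma integral_exp_intCast_mul (k : ℤ) :
    ∫ θ, Complex.exp (2 * Real.pi * Complex.I * k * (θ : ℝ))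
      ∂((volume : Measure ℝ).restrict (Set.Ico 0 1)) = if k = 0 then 1 else 0 := by
  rw [integral_Ico_eq_integral_Ioc, ← intervalIntegral.integral_of_le zero_le_one]
  split_ifs with h
  · simp [h]
  · have hk : (2 * Real.pi * Complex.I * k : ℂ) ≠ 0 := by
      simp [h, Real.pi_ne_zero]
    rw [integral_exp_mul_complex hk]
    have : Complex.exp (2 * Real.pi * Complex.I * k * (1 : ℝ)) = 1 := by
      rw [Complex.exp_eq_one_iff]
      exact ⟨k, by push_cast; ring⟩
    rw [this]
    simp

lemma integral_torusChar {d : ℕ} (k : Fin d → ℤ) :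
    ∫ x, torusChar k x ∂(torusHaar d) = if k = 0 then 1 else 0 := by
  rw [torusHaar_eq_map_pi, integral_map (measurable_angleMap d).aemeasurable
    (torusChar.continuous k).aestronglyMeasurable]
  have h : ∀ θ : Fin d → ℝ, torusChar k (angleMap d θ) =
      ∏ l, Complex.exp (2 * Real.pi * Complex.I * k l * (θ l : ℝ)) := by
    intro θ
    refine (map_prod Circle.coeHom _ _).trans (Finset.prod_congr rfl fun l _ => ?_)
    change ((Circle.exp (2 * Real.pi * θ l) ^ k l : Circle) : ℂ) = _
    rw [Circle.coe_zpow, Circle.coe_exp, ← Complex.exp_int_mul]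
    congr 1
    push_cast
    ring
  simp_rw [h]
  rw [integral_fintype_prod_eq_prod
    (fun l (t : ℝ) => Complex.exp (2 * Real.pi * Complex.I * k l * t))]
  simp_rw [integral_exp_intCast_mul]
  split_ifs with hk
  · simp [hk]
  · obtain ⟨l, hl⟩ := Function.ne_iff.mp hk
    exact Finset.prod_eq_zero (Finset.mem_univ l) (if_neg hl)

lemma Continuous.integrable_torusHaar {d : ℕ} {E : Type*} [NormedAddCommGroup E]
    [SecondCountableTopology E] {f : Torus d → E}
    (hf : Continuous f) : Integrable f (torusHaar d) := by
  obtain ⟨C, hC⟩ := isCompact_univ.exists_bound_of_continuousOn hf.continuousOn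
  exact Integrable.of_bound hf.aestronglyMeasurable C (ae_of_all _ fun x => hC x (Set.mem_univ x))

lemma integral_trigPoly {d : ℕ} (D : ℕ) (c : (Fin d → ℤ) → ℂ) :
    ∫ x, trigPoly D c x ∂(torusHaar d) = c 0 := by
  unfold trigPoly
  rw [integral_finsetSum _ fun k _ =>
    (torusChar.continuous k).integrable_torusHaar.const_mul (c k)]
  simp_rw [integral_const_mul, integral_torusChar]
  simp [zero_mem_freqBox]

/-! ### Density of trigonometric polynomials -/

/-- Stone–Weierstrass: linear combinations of characters are uniformly dense in the continuous
functions on the torus. -/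
lemma exists_span_torusChar_near {d : ℕ} {f : Torus d → ℂ} (hf : Continuous f) {ε : ℝ}
    (hε : 0 < ε) : ∃ p ∈ Submodule.span ℂ (Set.range (torusChar (d := d))),
      ∀ x, ‖f x - p x‖ ≤ ε := by
  let χ : (Fin d → ℤ) → C(Torus d, ℂ) := fun k => ⟨torusChar k, torusChar.continuous k⟩
  let A : StarSubalgebra ℂ C(Torus d, ℂ) :=
    { toSubalgebra := Algebra.adjoin ℂ (Set.range χ)
      star_mem' := by
        change Algebra.adjoin ℂ (Set.range χ) ≤ star (Algebra.adjoin ℂ (Set.range χ))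
        refine Algebra.adjoin_le ?_
        rintro _ ⟨k, rfl⟩
        refine Algebra.subset_adjoin ⟨-k, ?_⟩
        ext1 x
        exact torusChar.freq_neg k x }
  have hA : A.toSubalgebra.toSubmodule = Submodule.span ℂ (Set.range χ) := by
    apply Algebra.adjoin_eq_span_of_subset
    refine .trans (fun x ↦ Submonoid.closure_induction (fun _ ↦ id) ⟨0, ?_⟩ ?_)
      Submodule.subset_span
    · ext1 x
      exact torusChar.freq_zero x
    · rintro _ _ _ _ ⟨k, rfl⟩ ⟨k', rfl⟩
      refine ⟨k + k', ?_⟩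
      ext1 x
      exact torusChar.freq_add k k' x
  have hsep : A.SeparatesPoints := by
    intro x y hxy
    obtain ⟨i, hi⟩ := Function.ne_iff.mp hxy
    refine ⟨_, ⟨χ (Pi.single i 1), Algebra.subset_adjoin ⟨_, rfl⟩, rfl⟩, ?_⟩
    have h : ∀ z : Torus d, torusChar (Pi.single i 1) z = z i := by
      intro z
      rw [torusChar, Finset.prod_eq_single i]
      · simp
      · intro b _ hb
        simp [Pi.single_eq_of_ne hb]
      · simp
    change torusChar _ x ≠ torusChar _ y
    rw [h, h]
    exact fun hc => hi (Circle.ext hc)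
  have htop := ContinuousMap.starSubalgebra_topologicalClosure_eq_top_of_separatesPoints A hsep
  have hmem : (⟨f, hf⟩ : C(Torus d, ℂ)) ∈ closure (A : Set C(Torus d, ℂ)) := by
    rw [← StarSubalgebra.topologicalClosure_coe, htop]
    trivial
  obtain ⟨p, hpA, hp⟩ := Metric.mem_closure_iff.mp hmem ε hε
  refine ⟨p, ?_, fun x => ?_⟩
  · have hp' : p ∈ Submodule.span ℂ (Set.range χ) := by
      rw [← hA]; exact hpA
    clear hp hpA
    induction hp' using Submodule.span_induction with
    | mem x hx =>
      obtain ⟨k, rfl⟩ := hx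
      exact Submodule.subset_span ⟨k, rfl⟩
    | zero => exact Submodule.zero_mem _
    | add x y _ _ hx hy => exact Submodule.add_mem _ hx hy
    | smul a x _ hx => exact Submodule.smul_mem _ a hx
  · have := ContinuousMap.dist_le_iff_of_nonempty.mp hp.le x
    rwa [dist_eq_norm] at this

/-! ### Cyclic subgroups of the torus that resolve all low frequencies -/

/-- The homomorphism `y ↦ (exp (2πi q₁ y / M), …, exp (2πi q_d y / M))` from `ℤ/M` to the torus. A
single cyclic group suffices in every dimension: there is no need for a full grid `(ℤ/N)ᵈ`, which
is not cyclic. -/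
noncomputable def cyclicEmb {d : ℕ} (M : ℕ) [NeZero M] (q : Fin d → ℤ) (y : ZMod M) : Torus d :=
  fun l => ZMod.toCircle ((q l : ZMod M) * y)

/-- The frequency in `ℤ/M` of the restriction of the character `k` along `cyclicEmb M q`. -/
def dualFreq {d : ℕ} (M : ℕ) (q k : Fin d → ℤ) : ZMod M :=
  ∑ l, (k l : ZMod M) * (q l : ZMod M)

section DualFreq

variable {d : ℕ} {M : ℕ} {q : Fin d → ℤ}

lemma dualFreq_sub (k k' : Fin d → ℤ) :
    dualFreq M q (k - k') = dualFreq M q k - dualFreq M q k' := by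
  simp [dualFreq, sub_mul]

lemma dualFreq_smul (a : ℤ) (k : Fin d → ℤ) :
    dualFreq M q (a • k) = a * dualFreq M q k := by
  simp [dualFreq, Finset.mul_sum, mul_assoc]

lemma dualFreq_sum_smul {ι : Type*} (s : Finset ι) (b : ι → ℤ) (k : ι → Fin d → ℤ) :
    dualFreq M q (∑ j ∈ s, b j • k j) = ∑ j ∈ s, (b j : ZMod M) * dualFreq M q (k j) := by
  simp only [dualFreq, Finset.sum_apply, Pi.smul_apply, smul_eq_mul, Int.cast_sum, Int.cast_mul,
    Finset.sum_mul, Finset.mul_sum]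
  rw [Finset.sum_comm]
  simp [mul_assoc]

variable [NeZero M]

lemma torusChar_cyclicEmb (k : Fin d → ℤ) (y : ZMod M) :
    torusChar k (cyclicEmb M q y) = ZMod.stdAddChar (dualFreq M q k * y) := by
  rw [ZMod.stdAddChar_apply, torusChar]
  congr 1
  simp only [cyclicEmb, dualFreq, Finset.sum_mul,
    ← AddChar.map_zsmul_eq_zpow, zsmul_eq_mul, mul_assoc]
  exact (map_prod (ZMod.toCircle (N := M)).toMonoidHom
    (fun l => Multiplicative.ofAdd ((k l : ZMod M) * (q l * y))) Finset.univ).symm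

end DualFreq

/-- Nontrivial characters with frequency in the cube of size `R` remain nontrivial when restricted
along `cyclicEmb M q`. -/
def ResolvesFreq {d : ℕ} (R M : ℕ) (q : Fin d → ℤ) : Prop :=
  ∀ k ∈ freqBox d R, dualFreq M q k = 0 → k = 0

lemma ResolvesFreq.eq_of_dualFreq_eq {d R M D D' : ℕ} {q : Fin d → ℤ} (h : ResolvesFreq R M q)
    {k k' : Fin d → ℤ} (hk : k ∈ freqBox d D) (hk' : k' ∈ freqBox d D') (hR : D + D' ≤ R)
    (heq : dualFreq M q k = dualFreq M q k') : k = k' := by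
  refine sub_eq_zero.mp (h _ (mem_freqBox.mpr fun l => ?_) (by rw [dualFreq_sub, heq, sub_self]))
  have h1 := mem_freqBox.mp hk l
  have h2 := mem_freqBox.mp hk' l
  have h3 := abs_sub (k l) (k' l)
  simp only [Pi.sub_apply]
  omega

/-- Digits of absolute value less than the base are determined by the number they represent. -/
lemma eq_zero_of_sum_mul_pow_eq_zero {Q : ℤ} (hQ : 0 < Q) :
    ∀ {d : ℕ} (k : Fin d → ℤ), (∀ l, |k l| < Q) → ∑ l, k l * Q ^ (l : ℕ) = 0 → k = 0
  | 0, k, _, _ => Subsingleton.elim _ _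
  | d + 1, k, hk, hsum => by
    rw [Fin.sum_univ_succ] at hsum
    have h1 : ∑ l : Fin d, k l.succ * Q ^ ((l.succ : Fin (d + 1)) : ℕ)
        = Q * ∑ l : Fin d, k l.succ * Q ^ (l : ℕ) := by
      rw [Finset.mul_sum]
      refine Finset.sum_congr rfl fun l _ => ?_
      rw [Fin.val_succ, pow_succ]
      ring
    rw [h1] at hsum
    have h0 : k 0 = 0 := by
      refine Int.eq_zero_of_abs_lt_dvd (m := Q) ⟨-∑ l : Fin d, k l.succ * Q ^ (l : ℕ), ?_⟩ (hk 0)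
      simp at hsum
      linarith
    have h2 : (fun l : Fin d => k l.succ) = 0 := by
      refine eq_zero_of_sum_mul_pow_eq_zero hQ _ (fun l => hk _) ?_
      rw [h0] at hsum
      simpa [hQ.ne'] using hsum
    funext l
    refine Fin.cases h0 (fun l => ?_) l
    exact congrFun h2 l

/-- Take `q = (1, R + 1, (R + 1)², …)` and `M` larger than any `∑ₗ kₗ qₗ` with `|kₗ| ≤ R`. -/
lemma exists_resolvesFreq (d R : ℕ) : ∃ (M : ℕ) (q : Fin d → ℤ), M ≠ 0 ∧ ResolvesFreq R M q := by
  let Q : ℤ := R + 1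
  let M : ℕ := ∑ l : Fin d, R * (R + 1) ^ (l : ℕ) + 1
  refine ⟨M, fun l => Q ^ (l : ℕ), by simp [M], fun k hk hzero => ?_⟩
  rw [mem_freqBox] at hk
  refine eq_zero_of_sum_mul_pow_eq_zero (Q := Q) (by positivity) k
    (fun l => (hk l).trans_lt (by simp [Q])) ?_
  refine Int.eq_zero_of_abs_lt_dvd (m := (M : ℤ)) ?_ ?_
  · rw [← ZMod.intCast_zmod_eq_zero_iff_dvd]
    simpa [dualFreq] using hzero
  · calc |∑ l, k l * Q ^ (l : ℕ)| ≤ ∑ l, |k l * Q ^ (l : ℕ)| := Finset.abs_sum_le_sum_abs _ _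
      _ ≤ ∑ l : Fin d, R * (R + 1 : ℤ) ^ (l : ℕ) := by
        refine Finset.sum_le_sum fun l _ => ?_
        rw [abs_mul, abs_of_nonneg (by positivity : 0 ≤ Q ^ (l : ℕ))]
        exact mul_le_mul_of_nonneg_right (hk l) (by positivity)
      _ < M := by simp [M]

/-! ### Averages over resolving subgroups -/

section Averages

variable {d : ℕ} {M : ℕ} [NeZero M] {q : Fin d → ℤ}

lemma sum_stdAddChar_mul (r : ZMod M) :
    ∑ y : ZMod M, ZMod.stdAddChar (r * y) = if r = 0 then (M : ℂ) else 0 := by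
  have := AddChar.sum_mulShift r (ZMod.isPrimitive_stdAddChar M)
  simp_rw [mul_comm r]
  rw [this]
  split_ifs <;> simp [ZMod.card]

lemma average_torusChar {R : ℕ} (h : ResolvesFreq R M q) {k : Fin d → ℤ} (hk : k ∈ freqBox d R) :
    (M : ℂ)⁻¹ * ∑ y : ZMod M, torusChar k (cyclicEmb M q y) = ∫ x, torusChar k x ∂(torusHaar d) := by
  simp_rw [torusChar_cyclicEmb, sum_stdAddChar_mul, integral_torusChar]
  have hM : (M : ℂ) ≠ 0 := NeZero.ne _
  by_cases h0 : k = 0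
  · simp [h0, dualFreq, hM]
  · rw [if_neg (fun hz => h0 (h k hk hz)), if_neg h0, mul_zero]

lemma sum_trigPoly_cyclicEmb {R D : ℕ} (h : ResolvesFreq R M q) (hD : D ≤ R)
    (c : (Fin d → ℤ) → ℂ) :
    (M : ℂ)⁻¹ * ∑ y : ZMod M, trigPoly D c (cyclicEmb M q y) = c 0 := by
  rw [← integral_trigPoly D c]
  unfold trigPoly
  rw [integral_finsetSum _ fun k _ =>
    (torusChar.continuous k).integrable_torusHaar.const_mul (c k), Finset.sum_comm,
    Finset.mul_sum]
  refine Finset.sum_congr rfl fun k hk => ?_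
  rw [← Finset.mul_sum, mul_left_comm, average_torusChar h, integral_const_mul]
  rw [mem_freqBox] at hk ⊢
  exact fun l => (hk l).trans (by exact_mod_cast hD)

end Averages

/-- Equidistribution: averages of a continuous function over subgroups that resolve more and more
frequencies converge to its Haar integral. -/
lemma tendsto_average_cyclicEmb {d : ℕ} (M : ℕ → ℕ) [∀ R, NeZero (M R)] (q : ℕ → Fin d → ℤ)
    (h : ∀ R, ResolvesFreq R (M R) (q R)) {f : Torus d → ℂ} (hf : Continuous f) :
    Tendsto (fun R => (M R : ℂ)⁻¹ * ∑ y : ZMod (M R), f (cyclicEmb (M R) (q R) y)) atTop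
      (𝓝 (∫ x, f x ∂(torusHaar d))) := by
  -- For combinations of characters the averages are eventually equal to the integral.
  have hspan : ∀ p ∈ Submodule.span ℂ (Set.range (torusChar (d := d))), Continuous p ∧
      ∀ᶠ R in atTop, (M R : ℂ)⁻¹ * ∑ y : ZMod (M R), p (cyclicEmb (M R) (q R) y)
        = ∫ x, p x ∂(torusHaar d) := by
    intro p hp
    induction hp using Submodule.span_induction with
    | mem p hp =>
      obtain ⟨k, rfl⟩ := hp
      refine ⟨torusChar.continuous k, ?_⟩
      filter_upwards [eventually_ge_atTop (∑ l, (k l).natAbs)] with R hR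
      refine average_torusChar (h R) (mem_freqBox.mpr fun l => ?_)
      have : (k l).natAbs ≤ ∑ l, (k l).natAbs :=
        Finset.single_le_sum (f := fun l => (k l).natAbs) (fun _ _ => Nat.zero_le _)
          (Finset.mem_univ l)
      rw [Int.abs_eq_natAbs]
      exact_mod_cast this.trans hR
    | zero => exact ⟨continuous_const, by simp⟩
    | add f g _ _ hf hg =>
      refine ⟨hf.1.add hg.1, ?_⟩
      filter_upwards [hf.2, hg.2] with R h1 h2
      simp only [Pi.add_apply]
      rw [integral_add hf.1.integrable_torusHaar hg.1.integrable_torusHaar,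
        Finset.sum_add_distrib, mul_add, h1, h2]
    | smul a f _ hf =>
      refine ⟨hf.1.const_smul a, ?_⟩
      filter_upwards [hf.2] with R h1
      simp only [Pi.smul_apply, smul_eq_mul]
      rw [integral_const_mul, ← Finset.mul_sum, mul_left_comm, h1]
  rw [Metric.tendsto_atTop']
  intro ε hε
  obtain ⟨p, hp, hfp⟩ := exists_span_torusChar_near hf (show 0 < ε / 3 by positivity)
  obtain ⟨hpc, hpe⟩ := hspan p hp
  obtain ⟨N, hN⟩ := eventually_atTop.mp hpe
  refine ⟨N, fun R hR => ?_⟩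
  have hM : (0 : ℝ) < M R := by exact_mod_cast Nat.pos_of_ne_zero (NeZero.ne _)
  have h1 : ‖(M R : ℂ)⁻¹ * ∑ y : ZMod (M R), f (cyclicEmb (M R) (q R) y)
      - (M R : ℂ)⁻¹ * ∑ y : ZMod (M R), p (cyclicEmb (M R) (q R) y)‖ ≤ ε / 3 := by
    rw [← mul_sub, ← Finset.sum_sub_distrib, norm_mul, norm_inv, Complex.norm_natCast,
      inv_mul_le_iff₀ hM]
    refine (norm_sum_le_of_le _ fun y _ => hfp _).trans ?_
    simp [ZMod.card]
  have h2 : ‖∫ x, f x ∂(torusHaar d) - ∫ x, p x ∂(torusHaar d)‖ ≤ ε / 3 := by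
    rw [← integral_sub hf.integrable_torusHaar hpc.integrable_torusHaar]
    refine (norm_integral_le_of_norm_le_const (ae_of_all _ hfp)).trans ?_
    simp
  rw [hN R hR.le] at h1
  rw [dist_eq_norm]
  calc _ ≤ _ := norm_sub_le_norm_sub_add_norm_sub _ (∫ x, p x ∂(torusHaar d)) _
    _ ≤ ε / 3 + ε / 3 := add_le_add h1 (by rwa [norm_sub_rev])
    _ < ε := by linarith

lemma tendsto_average_cyclicEmb_real {d : ℕ} (M : ℕ → ℕ) [∀ R, NeZero (M R)] (q : ℕ → Fin d → ℤ)
    (h : ∀ R, ResolvesFreq R (M R) (q R)) {f : Torus d → ℝ} (hf : Continuous f) :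
    Tendsto (fun R => (M R : ℝ)⁻¹ * ∑ y : ZMod (M R), f (cyclicEmb (M R) (q R) y)) atTop
      (𝓝 (∫ x, f x ∂(torusHaar d))) := by
  have h1 := tendsto_average_cyclicEmb M q h (Complex.continuous_ofReal.comp hf)
  simp only [Function.comp_apply, integral_complex_ofReal] at h1
  rw [← Complex.ofReal_re (∫ x, f x ∂(torusHaar d))]
  refine ((Complex.continuous_re.tendsto _).comp h1).congr fun R => ?_
  rw [Function.comp_apply, ← Complex.ofReal_sum, ← Complex.ofReal_natCast, ← Complex.ofReal_inv,
    ← Complex.ofReal_mul, Complex.ofReal_re]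

/-! ### Integer combinations of trigonometric laws on a cyclic group -/

/-- The Fourier coefficients of the law of `∑ⱼ aⱼ Xⱼ` when the independent `Xⱼ` have
Fourier coefficients `cⱼ`. -/
noncomputable def combCoeff {d m : ℕ} (a : Fin m → ℤ) (c : Fin m → (Fin d → ℤ) → ℂ)
    (k : Fin d → ℤ) : ℂ :=
  ∏ j, c j (a j • k)

section CombCoeff

variable {d m D R M : ℕ} {q : Fin d → ℤ} {a b : Fin m → ℤ}
  {c : Fin m → (Fin d → ℤ) → ℂ}

lemma combCoeff_eq_zero (hab : ∑ j, a j * b j = 1)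
    (hc : ∀ j, ∀ k ∉ freqBox d D, c j k = 0) {k : Fin d → ℤ} (hk : k ∉ freqBox d D) :
    combCoeff a c k = 0 := by
  obtain ⟨j, hj⟩ : ∃ j, a j ≠ 0 := by
    by_contra! h
    simp [h] at hab
  refine Finset.prod_eq_zero (Finset.mem_univ j) (hc j _ fun hmem => hk ?_)
  rw [mem_freqBox] at hmem ⊢
  intro l
  refine le_trans ?_ (hmem l)
  rw [Pi.smul_apply, smul_eq_mul, abs_mul]
  exact le_mul_of_one_le_left (abs_nonneg _) (Int.one_le_abs hj)

/-- A resolution that suffices to compute the law of `∑ⱼ aⱼ Zⱼ` from that of the `Zⱼ`, for laws of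
degree at most `D`; here `b` are Bézout coefficients for `a`. -/
def sufficientResolution (D : ℕ) (a b : Fin m → ℤ) : ℕ :=
  D + (1 + ∑ j, (a j).natAbs) * ((∑ j, (b j).natAbs) * D)

lemma smul_mem_freqBox {a : ℤ} {A D : ℕ} (ha : a.natAbs ≤ A) {k : Fin d → ℤ}
    (hk : k ∈ freqBox d D) : a • k ∈ freqBox d (A * D) := by
  rw [mem_freqBox] at hk ⊢
  intro l
  rw [Pi.smul_apply, smul_eq_mul, abs_mul]
  push_cast
  exact mul_le_mul (by rw [Int.abs_eq_natAbs]; exact_mod_cast ha) (hk l) (abs_nonneg _)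
    (by positivity)

lemma sum_smul_mem_freqBox (b : Fin m → ℤ) {k : Fin m → Fin d → ℤ}
    (hk : ∀ j, k j ∈ freqBox d D) :
    ∑ j, b j • k j ∈ freqBox d ((∑ j, (b j).natAbs) * D) := by
  rw [mem_freqBox]
  intro l
  rw [Finset.sum_apply]
  refine (Finset.abs_sum_le_sum_abs _ _).trans ?_
  push_cast
  rw [Finset.sum_mul]
  refine Finset.sum_le_sum fun j _ => ?_
  rw [Pi.smul_apply, smul_eq_mul, abs_mul]
  exact mul_le_mul_of_nonneg_left (mem_freqBox.mp (hk j) l) (abs_nonneg _)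

/-- No aliasing: because the `aⱼ` are coprime, a frequency `s` of `ℤ/M` all of whose multiples
`aⱼ s` lift to bounded frequencies of the torus lifts itself, and all these lifts are compatible. -/
lemma prod_sum_dualFreq_eq (hab : ∑ j, a j * b j = 1)
    (hc : ∀ j, ∀ k ∉ freqBox d D, c j k = 0)
    (h : ResolvesFreq R M q) (hR : sufficientResolution D a b ≤ R) (s : ZMod M) :
    ∏ j, ∑ k ∈ freqBox d D with dualFreq M q k = a j * s, c j k =
      ∑ k ∈ freqBox d D with dualFreq M q k = s, combCoeff a c k := by
  unfold sufficientResolution at hR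
  set B := ∑ j, (b j).natAbs with hB
  set A := ∑ j, (a j).natAbs with hA
  have hA' : ∀ j, (a j).natAbs ≤ A := fun j =>
    Finset.single_le_sum (f := fun j => (a j).natAbs) (fun _ _ => Nat.zero_le _)
      (Finset.mem_univ j)
  have hR1 : D + B * D ≤ R := le_trans (by nlinarith [Nat.zero_le (A * (B * D))]) hR
  have hR2 : D + A * (B * D) ≤ R := le_trans (by nlinarith [Nat.zero_le (B * D)]) hR
  by_cases hs : ∃ k ∈ freqBox d (B * D), dualFreq M q k = s
  · obtain ⟨k, hk, hks⟩ := hs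
    have hleft : ∀ j, ∑ k' ∈ freqBox d D with dualFreq M q k' = a j * s, c j k' =
        c j (a j • k) := by
      intro j
      have huniq : ∀ k' ∈ freqBox d D, dualFreq M q k' = a j * s → k' = a j • k := by
        intro k' hk' hks'
        refine h.eq_of_dualFreq_eq hk' (smul_mem_freqBox (hA' j) hk) hR2 ?_
        rw [hks', dualFreq_smul, hks]
      refine Finset.sum_eq_single _ ?_ ?_
      · intro k' hk' hne
        rw [Finset.mem_filter] at hk'
        exact absurd (huniq k' hk'.1 hk'.2) hne
      · intro hnot
        refine hc j _ fun hmem => hnot ?_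
        rw [Finset.mem_filter, dualFreq_smul, hks]
        exact ⟨hmem, rfl⟩
    simp_rw [hleft]
    symm
    refine Finset.sum_eq_single _ ?_ ?_
    · intro k' hk' hne
      rw [Finset.mem_filter] at hk'
      exact absurd (h.eq_of_dualFreq_eq hk'.1 hk hR1 (hk'.2.trans hks.symm)) hne
    · intro hnot
      refine combCoeff_eq_zero hab hc fun hmem => hnot ?_
      rw [Finset.mem_filter]
      exact ⟨hmem, hks⟩
  · have hright : ∑ k ∈ freqBox d D with dualFreq M q k = s, combCoeff a c k = 0 := by
      refine Finset.sum_eq_zero fun k hk => ?_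
      rw [Finset.mem_filter] at hk
      by_contra hne
      -- If all coefficients `cⱼ (aⱼ k)` are nonzero then `k` is small by Bézout.
      have hmem : ∀ j, a j • k ∈ freqBox d D := fun j => by
        by_contra hnot
        exact hne (Finset.prod_eq_zero (Finset.mem_univ j) (hc j _ hnot))
      refine hs ⟨k, ?_, hk.2⟩
      have hsum := sum_smul_mem_freqBox b hmem
      simp_rw [smul_smul, ← Finset.sum_smul, mul_comm (b _), hab, one_smul] at hsum
      exact hsum
    rw [hright]
    by_contra hne
    rw [← ne_eq, Finset.prod_ne_zero_iff] at hne
    have hex : ∀ j, ∃ k ∈ freqBox d D, dualFreq M q k = a j * s := by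
      intro j
      obtain ⟨k, hk, -⟩ := Finset.exists_ne_zero_of_sum_ne_zero (hne j (Finset.mem_univ j))
      exact ⟨k, Finset.mem_filter.mp hk⟩
    choose k hk hks using hex
    refine hs ⟨∑ j, b j • k j, sum_smul_mem_freqBox b hk, ?_⟩
    rw [dualFreq_sum_smul]
    simp_rw [hks, ← mul_assoc, ← Finset.sum_mul]
    have : ∑ j, ((b j : ZMod M) * (a j : ZMod M)) = 1 := by
      have := congrArg (Int.cast : ℤ → ZMod M) hab
      push_cast at this
      simpa [mul_comm] using this
    rw [this, one_mul]

variable [NeZero M]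

lemma sum_stdAddChar_mul_trigPoly (c : (Fin d → ℤ) → ℂ) (r : ZMod M) :
    ∑ x : ZMod M, ZMod.stdAddChar (-(r * x)) * trigPoly D c (cyclicEmb M q x) =
      M * ∑ k ∈ freqBox d D with dualFreq M q k = r, c k := by
  unfold trigPoly
  simp_rw [Finset.mul_sum, torusChar_cyclicEmb]
  rw [Finset.sum_comm, Finset.sum_filter]
  refine Finset.sum_congr rfl fun k _ => ?_
  have : ∀ x : ZMod M, ZMod.stdAddChar (-(r * x)) * (c k * ZMod.stdAddChar (dualFreq M q k * x))
      = c k * ZMod.stdAddChar ((dualFreq M q k - r) * x) := by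
    intro x
    rw [mul_left_comm, ← AddChar.map_add_eq_mul]
    ring_nf
  simp_rw [this, ← Finset.mul_sum, sum_stdAddChar_mul, sub_eq_zero]
  split_ifs <;> ring

/-- If independent `Zⱼ` on `ℤ/M` have the laws `x ↦ M⁻¹ pⱼ(x)` with `pⱼ` trigonometric polynomials
restricted to a sufficiently resolving subgroup, then `∑ⱼ aⱼ Zⱼ` has the law `y ↦ M⁻¹ g(y)` with `g`
the trigonometric polynomial with coefficients `combCoeff a c`. No error term occurs. -/
lemma sum_prod_trigPoly_eq (hab : ∑ j, a j * b j = 1)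
    (hc : ∀ j, ∀ k ∉ freqBox d D, c j k = 0)
    (h : ResolvesFreq R M q) (hR : sufficientResolution D a b ≤ R) (y : ZMod M) :
    ∑ x : Fin m → ZMod M with ∑ j, a j • x j = y,
        ∏ j, ((M : ℂ)⁻¹ * trigPoly D (c j) (cyclicEmb M q (x j))) =
      (M : ℂ)⁻¹ * trigPoly D (combCoeff a c) (cyclicEmb M q y) := by
  have hM : (M : ℂ) ≠ 0 := NeZero.ne _
  let F : Fin m → ZMod M → ℂ := fun j x => (M : ℂ)⁻¹ * trigPoly D (c j) (cyclicEmb M q x)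
  have hF : ∀ j (r : ZMod M), ∑ x, ZMod.stdAddChar (-(r * x)) * F j x =
      ∑ k ∈ freqBox d D with dualFreq M q k = r, c j k := by
    intro j r
    simp only [F]
    simp_rw [mul_left_comm _ (M : ℂ)⁻¹]
    rw [← Finset.mul_sum, sum_stdAddChar_mul_trigPoly, inv_mul_cancel_left₀ hM]
  -- Detect the condition `∑ aⱼ xⱼ = y` by a sum over all characters of `ℤ/M`.
  have hdetect : ∀ x : Fin m → ZMod M,
      (if ∑ j, a j • x j = y then ∏ j, F j (x j) else 0) =
        (M : ℂ)⁻¹ * ∑ s : ZMod M, ZMod.stdAddChar (s * y) *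
          ∏ j, (ZMod.stdAddChar (-((a j : ZMod M) * s * x j)) * F j (x j)) := by
    intro x
    have hs : ∀ s : ZMod M, ZMod.stdAddChar (s * y) *
          ∏ j, (ZMod.stdAddChar (-((a j : ZMod M) * s * x j)) * F j (x j)) =
        ZMod.stdAddChar ((y - ∑ j, a j • x j) * s) * ∏ j, F j (x j) := by
      intro s
      rw [Finset.prod_mul_distrib, ← mul_assoc]
      congr 1
      have hp : ∏ j, (ZMod.stdAddChar (-((a j : ZMod M) * s * x j)) : ℂ) =
          ZMod.stdAddChar (∑ j, -((a j : ZMod M) * s * x j)) :=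
        (map_prod (ZMod.stdAddChar (N := M)).toMonoidHom
          (fun j => Multiplicative.ofAdd (-((a j : ZMod M) * s * x j))) Finset.univ).symm
      rw [hp, ← AddChar.map_add_eq_mul]
      congr 1
      simp only [Finset.sum_neg_distrib, zsmul_eq_mul, sub_mul, Finset.sum_mul]
      rw [← sub_eq_add_neg, mul_comm s y]
      congr 1
      exact Finset.sum_congr rfl fun j _ => by ring
    simp_rw [hs, ← Finset.sum_mul, sum_stdAddChar_mul, sub_eq_zero, eq_comm (a := y)]
    split_ifs
    · rw [inv_mul_cancel_left₀ hM]
    · simp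
  rw [Finset.sum_filter, Finset.sum_congr rfl fun x _ => hdetect x]
  rw [← Finset.mul_sum, Finset.sum_comm]
  congr 1
  simp_rw [← Finset.mul_sum]
  have hprod : ∀ s : ZMod M, ∑ x : Fin m → ZMod M,
      ∏ j, (ZMod.stdAddChar (-((a j : ZMod M) * s * x j)) * F j (x j)) =
        ∑ k ∈ freqBox d D with dualFreq M q k = s, combCoeff a c k := by
    intro s
    rw [← prod_sum_dualFreq_eq hab hc h hR]
    simp_rw [← hF]
    rw [Finset.prod_univ_sum, Fintype.piFinset_univ]
  simp_rw [hprod, Finset.mul_sum, Finset.sum_filter]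
  rw [Finset.sum_comm]
  unfold trigPoly
  refine Finset.sum_congr rfl fun k _ => ?_
  rw [Finset.sum_ite_eq, torusChar_cyclicEmb]
  simp [mul_comm]

end CombCoeff

section CombCoeffNonneg

variable {d m D : ℕ} {a b : Fin m → ℤ} {c : Fin m → (Fin d → ℤ) → ℂ}

lemma trigPoly_combCoeff_cyclicEmb_nonneg {R M : ℕ} [NeZero M] {q : Fin d → ℤ}
    (hab : ∑ j, a j * b j = 1)
    (hc : ∀ j, ∀ k ∉ freqBox d D, c j k = 0) (hpos : ∀ j x, 0 ≤ trigPoly D (c j) x)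
    (h : ResolvesFreq R M q) (hR : sufficientResolution D a b ≤ R) (y : ZMod M) :
    0 ≤ trigPoly D (combCoeff a c) (cyclicEmb M q y) := by
  have hM : (0 : ℂ) < M := by exact_mod_cast Nat.pos_of_ne_zero (NeZero.ne _)
  have h1 : 0 ≤ (M : ℂ)⁻¹ * trigPoly D (combCoeff a c) (cyclicEmb M q y) := by
    rw [← sum_prod_trigPoly_eq hab hc h hR y]
    exact Finset.sum_nonneg fun x _ => Finset.prod_nonneg fun j _ =>
      mul_nonneg (inv_nonneg.mpr hM.le) (hpos j _)
  have h2 := mul_nonneg hM.le h1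
  rwa [mul_inv_cancel_left₀ hM.ne'] at h2

lemma trigPoly_translate (c : (Fin d → ℤ) → ℂ) (t x : Torus d) :
    trigPoly D (fun k => c k * torusChar k t) x = trigPoly D c (t * x) := by
  unfold trigPoly
  refine Finset.sum_congr rfl fun k _ => ?_
  rw [torusChar.map_mul, mul_assoc]

/-- Translating the `j`-th polynomial by `x ^ bⱼ` translates the combined one by `x`, so nonnegativity
at the identity, a point of every finite cyclic subgroup, gives nonnegativity everywhere. -/
lemma trigPoly_combCoeff_nonneg (hab : ∑ j, a j * b j = 1)
    (hc : ∀ j, ∀ k ∉ freqBox d D, c j k = 0) (hpos : ∀ j x, 0 ≤ trigPoly D (c j) x)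
    (x : Torus d) : 0 ≤ trigPoly D (combCoeff a c) x := by
  obtain ⟨M, q, hM, h⟩ := exists_resolvesFreq d (sufficientResolution D a b)
  have : NeZero M := ⟨hM⟩
  let c' : Fin m → (Fin d → ℤ) → ℂ := fun j k => c j k * torusChar k (x ^ b j)
  have hcc : combCoeff a c' = fun k => combCoeff a c k * torusChar k x := by
    funext k
    simp only [combCoeff, c', Finset.prod_mul_distrib]
    congr 1
    simp_rw [torusChar.map_zpow, smul_smul, ← torusChar.map_zpow]
    have hprod : ∏ j, x ^ (b j * a j) = x ^ ∑ j, b j * a j :=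
      (map_prod (zpowersHom (Torus d) x) (fun j => Multiplicative.ofAdd (b j * a j))
        Finset.univ).symm
    rw [← torusChar.map_prod, hprod]
    simp_rw [mul_comm (b _)]
    rw [hab, zpow_one]
  have h0 := trigPoly_combCoeff_cyclicEmb_nonneg (c := c') hab
    (fun j k hk => by simp [c', hc j k hk])
    (fun j y => by simp only [c']; rw [trigPoly_translate]; exact hpos j _) h le_rfl 0
  rw [hcc, trigPoly_translate] at h0
  have h1 : cyclicEmb M q 0 = 1 := by
    funext l
    simp [cyclicEmb]
  rwa [h1, mul_one] at h0

end CombCoeffNonneg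

/-! ### The entropy inequality for trigonometric polynomial densities -/

/-- The linear inequality `∑ᵢ αᵢ H(∑ⱼ aᵢⱼ Zⱼ) ≤ 0` for independent random variables in finite cyclic
groups. -/
def CyclicEntropyIneq {n m : ℕ} (a : Fin n → Fin m → ℤ) (α : Fin n → ℝ) : Prop :=
  ∀ (G : Type) [AddCommGroup G] [IsAddCyclic G] [Fintype G]
    [MeasurableSpace G] [DiscreteMeasurableSpace G]
    (Ω : Type) [MeasurableSpace Ω] (P : Measure Ω) [IsProbabilityMeasure P]
    (Z : Fin m → Ω → G), (∀ j, Measurable (Z j)) → iIndepFun Z P →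
    ∑ i, α i * shannonEntropy P (fun ω => ∑ j, a i j • Z j ω) ≤ 0

lemma measureReal_pi_pmf_fiber {m : ℕ} {G S : Type*} [Fintype G] [MeasurableSpace G]
    [DiscreteMeasurableSpace G] [DecidableEq S] (p : Fin m → PMF G) (f : (Fin m → G) → S) (y : S) :
    (Measure.pi fun j => (p j).toMeasure).real (f ⁻¹' {y}) =
      ∑ x : Fin m → G with f x = y, ∏ j, (p j (x j)).toReal := by
  have : f ⁻¹' {y} = ((Finset.univ.filter fun x => f x = y : Finset (Fin m → G)) :
      Set (Fin m → G)) := by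
    ext x; simp
  rw [this, ← sum_measureReal_singleton]
  refine Finset.sum_congr rfl fun x _ => ?_
  rw [measureReal_def, Measure.pi_singleton, ENNReal.toReal_prod]
  refine Finset.prod_congr rfl fun j _ => ?_
  rw [PMF.toMeasure_apply_singleton _ _ (measurableSet_singleton _)]

/-- Shannon entropy exceeds the discretised differential entropy by exactly the logarithm of the
size of the group. -/
lemma sum_negMulLog_inv_mul {M : ℕ} [NeZero M] (g : ZMod M → ℝ) (hg : (M : ℝ)⁻¹ * ∑ y, g y = 1) :
    ∑ y, Real.negMulLog ((M : ℝ)⁻¹ * g y) =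
      Real.log M + (M : ℝ)⁻¹ * ∑ y, Real.negMulLog (g y) := by
  simp_rw [Real.negMulLog_mul, Finset.sum_add_distrib, ← Finset.sum_mul, ← Finset.mul_sum]
  congr 1
  rw [Real.negMulLog, Real.log_inv, neg_mul_neg, mul_comm, mul_right_comm, hg, one_mul]

lemma CyclicEntropyIneq.average_le {n m d D R M : ℕ} [NeZero M] {q : Fin d → ℤ}
    {a b : Fin n → Fin m → ℤ} {α : Fin n → ℝ} (hineq : CyclicEntropyIneq a α)
    (hα : ∑ i, α i = 0)
    {c : Fin m → (Fin d → ℤ) → ℂ} (hab : ∀ i, ∑ j, a i j * b i j = 1)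
    (hc : ∀ j, ∀ k ∉ freqBox d D, c j k = 0) (hpos : ∀ j x, 0 ≤ trigPoly D (c j) x)
    (hc0 : ∀ j, c j 0 = 1)
    (h : ResolvesFreq R M q) (hDR : D ≤ R) (hR : ∀ i, sufficientResolution D (a i) (b i) ≤ R) :
    ∑ i, α i * ((M : ℝ)⁻¹ * ∑ y : ZMod M,
      Real.negMulLog (trigPoly D (combCoeff (a i) c) (cyclicEmb M q y)).re) ≤ 0 := by
  let _ : MeasurableSpace (ZMod M) := ⊤
  have : DiscreteMeasurableSpace (ZMod M) := ⟨fun _ => trivial⟩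
  have hM0 : (0 : ℝ) ≤ (M : ℝ)⁻¹ := by positivity
  let w : Fin m → ZMod M → ℝ := fun j x => (M : ℝ)⁻¹ * (trigPoly D (c j) (cyclicEmb M q x)).re
  have hw : ∀ j x, 0 ≤ w j x := fun j x => mul_nonneg hM0 (Complex.nonneg_iff.mp (hpos j _)).1
  have hwc : ∀ j x, (w j x : ℂ) = (M : ℂ)⁻¹ * trigPoly D (c j) (cyclicEmb M q x) := by
    intro j x
    have hre := Complex.eq_re_of_ofReal_le (r := 0) (by simpa using hpos j (cyclicEmb M q x))
    simp only [w]
    push_cast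
    rw [← hre]
  have hsum : ∀ j, ∑ x, w j x = 1 := by
    intro j
    have : ((∑ x, w j x : ℝ) : ℂ) = 1 := by
      push_cast
      simp_rw [hwc]
      rw [← Finset.mul_sum, sum_trigPoly_cyclicEmb h hDR, hc0]
    exact_mod_cast this
  let p : Fin m → PMF (ZMod M) := fun j => PMF.ofFintype (fun x => ENNReal.ofReal (w j x)) (by
    rw [← ENNReal.ofReal_sum_of_nonneg fun x _ => hw j x, hsum j, ENNReal.ofReal_one])
  have hp : ∀ j x, (p j x).toReal = w j x := fun j x => by
    simp only [p, PMF.ofFintype_apply]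
    exact ENNReal.toReal_ofReal (hw j x)
  have key := hineq (ZMod M) (Fin m → ZMod M) (Measure.pi fun j => (p j).toMeasure)
    (fun j ω => ω j) (fun j => measurable_pi_apply j)
    (iIndepFun_pi (X := fun _ x => x) fun j => aemeasurable_id)
  have hent : ∀ i, shannonEntropy (Measure.pi fun j => (p j).toMeasure)
      (fun ω : Fin m → ZMod M => ∑ j, a i j • ω j) = Real.log M + (M : ℝ)⁻¹ * ∑ y : ZMod M,
        Real.negMulLog (trigPoly D (combCoeff (a i) c) (cyclicEmb M q y)).re := by
    intro i
    rw [← sum_negMulLog_inv_mul]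
    · unfold shannonEntropy
      refine Finset.sum_congr rfl fun y _ => ?_
      congr 1
      rw [measureReal_pi_pmf_fiber]
      simp_rw [hp]
      have := congrArg Complex.re (sum_prod_trigPoly_eq (hab i) hc h (hR i) y)
      simp_rw [← hwc] at this
      rw [← Complex.ofReal_natCast, ← Complex.ofReal_inv, Complex.re_ofReal_mul] at this
      rw [← this]
      norm_cast
    · have := congrArg Complex.re (sum_trigPoly_cyclicEmb h hDR (combCoeff (a i) c))
      rw [← Complex.ofReal_natCast, ← Complex.ofReal_inv, Complex.re_ofReal_mul,
        Complex.re_sum] at this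
      rw [this]
      simp [combCoeff, hc0]
  simp_rw [hent, mul_add, Finset.sum_add_distrib, ← Finset.sum_mul, hα, zero_mul, zero_add] at key
  exact key

lemma CyclicEntropyIneq.integral_le {n m d D : ℕ}
    {a b : Fin n → Fin m → ℤ} {α : Fin n → ℝ} (hineq : CyclicEntropyIneq a α)
    (hα : ∑ i, α i = 0)
    {c : Fin m → (Fin d → ℤ) → ℂ} (hab : ∀ i, ∑ j, a i j * b i j = 1)
    (hc : ∀ j, ∀ k ∉ freqBox d D, c j k = 0) (hpos : ∀ j x, 0 ≤ trigPoly D (c j) x)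
    (hc0 : ∀ j, c j 0 = 1) :
    ∑ i, α i * ∫ x, Real.negMulLog (trigPoly D (combCoeff (a i) c) x).re ∂(torusHaar d) ≤ 0 := by
  choose M q hM h using exists_resolvesFreq d
  have : ∀ R, NeZero (M R) := fun R => ⟨hM R⟩
  refine le_of_tendsto (tendsto_finsetSum Finset.univ fun i _ =>
    (tendsto_average_cyclicEmb_real M q h (Real.continuous_negMulLog.comp
      (Complex.continuous_re.comp (continuous_trigPoly D (combCoeff (a i) c))))).const_mul (α i)) ?_
  filter_upwards [eventually_ge_atTop D,
    eventually_ge_atTop (∑ i, sufficientResolution D (a i) (b i))] with R hDR hR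
  exact hineq.average_le hα hab hc hpos hc0 (h R) hDR fun i =>
    (Finset.single_le_sum (f := fun i => sufficientResolution D (a i) (b i))
      (fun _ _ => Nat.zero_le _) (Finset.mem_univ i)).trans hR

/-! ### Fejér kernels -/

/-- The `k`-th Fourier coefficient of the Fejér kernel `|B|⁻¹ |∑_{p ∈ B} χ_p|²`, `B = {0, …, N}ᵈ`:
the proportion of the `p ∈ B` with `p + k ∈ B`. -/
noncomputable def fejerCoeff {d : ℕ} (N : ℕ) (k : Fin d → ℤ) : ℂ :=
  ((Fintype.piFinset fun _ : Fin d => Finset.Icc (0 : ℤ) N).filter fun p =>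
      p + k ∈ Fintype.piFinset fun _ : Fin d => Finset.Icc (0 : ℤ) N).card /
    (Fintype.piFinset fun _ : Fin d => Finset.Icc (0 : ℤ) N).card

section Fejer

variable {d : ℕ}

lemma card_piFinset_Icc (d N : ℕ) :
    (Fintype.piFinset fun _ : Fin d => Finset.Icc (0 : ℤ) N).card = (N + 1) ^ d := by
  simp

lemma fejerCoeff_zero (N : ℕ) : fejerCoeff N (0 : Fin d → ℤ) = 1 := by
  unfold fejerCoeff
  simp only [add_zero, Finset.filter_mem_eq_inter, Finset.inter_self]
  refine div_self ?_
  rw [card_piFinset_Icc]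
  exact_mod_cast pow_ne_zero d N.succ_ne_zero

lemma fejerCoeff_eq_zero {N : ℕ} {k : Fin d → ℤ} (hk : k ∉ freqBox d N) : fejerCoeff N k = 0 := by
  unfold fejerCoeff
  rw [Finset.filter_false_of_mem, Finset.card_empty, Nat.cast_zero, zero_div]
  intro p hp hpk
  refine hk (mem_freqBox.mpr fun l => ?_)
  have h1 := Finset.mem_Icc.mp (Fintype.mem_piFinset.mp hp l)
  have h2 := Finset.mem_Icc.mp (Fintype.mem_piFinset.mp hpk l)
  rw [Pi.add_apply] at h2
  rw [abs_le]
  omega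

lemma trigPoly_fejerCoeff_nonneg (N : ℕ) (x : Torus d) : 0 ≤ trigPoly N (fejerCoeff N) x := by
  set B := Fintype.piFinset fun _ : Fin d => Finset.Icc (0 : ℤ) N with hB
  have h : trigPoly N (fejerCoeff N) x =
      (B.card : ℂ)⁻¹ * (star (∑ p ∈ B, torusChar p x) * ∑ p ∈ B, torusChar p x) := by
    unfold trigPoly fejerCoeff
    rw [← hB, star_sum, Finset.sum_mul_sum]
    simp_rw [← torusChar.freq_neg, ← torusChar.freq_add, div_eq_inv_mul, mul_assoc]
    rw [← Finset.mul_sum]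
    congr 1
    simp_rw [← nsmul_eq_mul, ← Finset.sum_const, Finset.sum_filter]
    rw [Finset.sum_comm]
    refine Finset.sum_congr rfl fun p hp => ?_
    rw [← Finset.sum_filter]
    refine Finset.sum_nbij' (fun k => p + k) (fun r => -p + r) ?_ ?_ ?_ ?_ ?_
    · intro k hk
      exact (Finset.mem_filter.mp hk).2
    · intro r hr
      rw [Finset.mem_filter, add_neg_cancel_left]
      refine ⟨mem_freqBox.mpr fun l => ?_, hr⟩
      have h1 := Finset.mem_Icc.mp (Fintype.mem_piFinset.mp hp l)
      have h2 := Finset.mem_Icc.mp (Fintype.mem_piFinset.mp hr l)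
      rw [Pi.add_apply, Pi.neg_apply, abs_le]
      omega
    · intro k _
      simp
    · intro r _
      simp
    · intro k _
      simp
  rw [h]
  exact mul_nonneg (by simp) (star_mul_self_nonneg _)

lemma tendsto_fejerCoeff (k : Fin d → ℤ) : Tendsto (fun N => fejerCoeff N k) atTop (𝓝 1) := by
  set K := ∑ l, (k l).natAbs with hK
  have hkK : ∀ l, |k l| ≤ K := by
    intro l
    have : (k l).natAbs ≤ ∑ l, (k l).natAbs := Finset.single_le_sum (f := fun l => (k l).natAbs)
      (fun _ _ => Nat.zero_le _) (Finset.mem_univ l)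
    rw [Int.abs_eq_natAbs]
    exact_mod_cast this
  -- Squeeze: `B ∩ (B - k)` contains the cube `{K, …, N - K}ᵈ`.
  let r : ℕ → ℝ := fun N =>
    (((Fintype.piFinset fun _ : Fin d => Finset.Icc (0 : ℤ) N).filter fun p =>
      p + k ∈ Fintype.piFinset fun _ : Fin d => Finset.Icc (0 : ℤ) N).card : ℝ) /
    ((N + 1 : ℕ) ^ d : ℕ)
  have hr : ∀ N, fejerCoeff N k = (r N : ℂ) := by
    intro N
    simp only [fejerCoeff, r, card_piFinset_Icc]
    push_cast
    rfl
  have hlim : Tendsto (fun N : ℕ => (1 - 2 * (K : ℝ) / ((N : ℝ) + 1)) ^ d) atTop (𝓝 1) := by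
    have h1 : Tendsto (fun N : ℕ => 2 * (K : ℝ) / ((N : ℝ) + 1)) atTop (𝓝 0) :=
      tendsto_const_nhds.div_atTop (tendsto_atTop_add_const_right _ _ tendsto_natCast_atTop_atTop)
    simpa using (h1.const_sub 1).pow d
  have hr1 : Tendsto r atTop (𝓝 1) := by
    refine tendsto_of_tendsto_of_tendsto_of_le_of_le' hlim tendsto_const_nhds ?_ ?_
    · filter_upwards [eventually_ge_atTop (2 * K)] with N hN
      have hsub : (Fintype.piFinset fun _ : Fin d => Finset.Icc (K : ℤ) (N - K)) ⊆
          ((Fintype.piFinset fun _ : Fin d => Finset.Icc (0 : ℤ) N).filter fun p =>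
            p + k ∈ Fintype.piFinset fun _ : Fin d => Finset.Icc (0 : ℤ) N) := by
        intro p hp
        have h1 := fun l => Finset.mem_Icc.mp (Fintype.mem_piFinset.mp hp l)
        have h2 := fun l => abs_le.mp (hkK l)
        rw [Finset.mem_filter, Fintype.mem_piFinset, Fintype.mem_piFinset]
        refine ⟨fun l => ?_, fun l => ?_⟩
        · have := h1 l
          rw [Finset.mem_Icc]
          omega
        · have := h1 l
          have := h2 l
          rw [Finset.mem_Icc, Pi.add_apply]
          omega
      have hcard := Finset.card_le_card hsub
      have hN1 : (0 : ℝ) < (N : ℝ) + 1 := by positivity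
      have hcard' : (Fintype.piFinset fun _ : Fin d => Finset.Icc (K : ℤ) (N - K)).card =
          (N + 1 - 2 * K) ^ d := by
        rw [Fintype.card_piFinset_const, Int.card_Icc]
        congr 1
        omega
      rw [hcard'] at hcard
      have h3 : (1 - 2 * (K : ℝ) / ((N : ℝ) + 1)) ^ d =
          ((N + 1 - 2 * K : ℕ) ^ d : ℕ) / ((N + 1 : ℕ) ^ d : ℕ) := by
        rw [Nat.cast_pow, Nat.cast_pow, ← div_pow, Nat.cast_sub (by omega)]
        congr 1
        push_cast
        field_simp
      rw [h3]
      exact div_le_div_of_nonneg_right (by exact_mod_cast hcard) (by positivity)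
    · refine Eventually.of_forall fun N => ?_
      refine div_le_one_of_le₀ ?_ (by positivity)
      rw [← card_piFinset_Icc]
      exact_mod_cast Finset.card_filter_le _ _
  simp_rw [hr]
  exact_mod_cast (Complex.continuous_ofReal.tendsto 1).comp hr1

end Fejer

/-! ### Convolution with a trigonometric kernel -/

/-- The convolution of `u` with the kernel `trigPoly D w`, given by its Fourier series. -/
noncomputable def trigConv {d : ℕ} (D : ℕ) (w : (Fin d → ℤ) → ℂ) (u : Torus d → ℂ) :
    Torus d → ℂ :=
  trigPoly D fun k => w k * ∫ x, torusChar (-k) x * u x ∂(torusHaar d)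

section TrigConv

variable {d D : ℕ} {w : (Fin d → ℤ) → ℂ} {u v : Torus d → ℂ}

lemma continuous_trigConv (D : ℕ) (w : (Fin d → ℤ) → ℂ) (u : Torus d → ℂ) :
    Continuous (trigConv D w u) :=
  continuous_trigPoly _ _

lemma integrable_torusChar_mul (k : Fin d → ℤ) (hu : Integrable u (torusHaar d)) :
    Integrable (fun x => torusChar k x * u x) (torusHaar d) :=
  hu.bdd_mul (torusChar.continuous k).aestronglyMeasurable
    (ae_of_all _ fun x => (torusChar.norm_eq_one k x).le)

lemma integral_trigPoly_div_left (x : Torus d) :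
    ∫ y, trigPoly D w (y / x) ∂(torusHaar d) = w 0 := by
  have h : ∀ y, trigPoly D w (y / x) = trigPoly D (fun k => w k * torusChar k x⁻¹) y := by
    intro y
    rw [trigPoly_translate, div_eq_inv_mul]
  simp_rw [h]
  rw [integral_trigPoly, torusChar.freq_zero, mul_one]

lemma trigConv_eq_integral (hu : Integrable u (torusHaar d)) (y : Torus d) :
    trigConv D w u y = ∫ x, trigPoly D w (y / x) * u x ∂(torusHaar d) := by
  unfold trigConv trigPoly
  have h : ∀ x, (∑ k ∈ freqBox d D, w k * torusChar k (y / x)) * u x =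
      ∑ k ∈ freqBox d D, w k * torusChar k y * (torusChar (-k) x * u x) := by
    intro x
    rw [Finset.sum_mul]
    refine Finset.sum_congr rfl fun k _ => ?_
    rw [torusChar.map_div]
    ring
  simp_rw [h]
  rw [integral_finsetSum _ fun k _ => (integrable_torusChar_mul (-k) hu).const_mul _]
  refine Finset.sum_congr rfl fun k _ => ?_
  rw [integral_const_mul]
  ring

lemma integral_trigPoly_div_right (y : Torus d) :
    ∫ x, trigPoly D w (y / x) ∂(torusHaar d) = w 0 := by
  have h := trigConv_eq_integral (D := D) (w := w) (u := fun _ => (1 : ℂ)) (integrable_const 1) y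
  simp only [mul_one] at h
  rw [← h]
  simp only [trigConv, trigPoly, mul_one, integral_torusChar, neg_eq_zero]
  simp [zero_mem_freqBox, torusChar.freq_zero]

lemma trigConv_add (hu : Integrable u (torusHaar d)) (hv : Integrable v (torusHaar d))
    (y : Torus d) : trigConv D w (u + v) y = trigConv D w u y + trigConv D w v y := by
  simp only [trigConv, trigPoly, Pi.add_apply, mul_add, ← Finset.sum_add_distrib, ← add_mul]
  refine Finset.sum_congr rfl fun k _ => ?_
  rw [integral_add (integrable_torusChar_mul _ hu) (integrable_torusChar_mul _ hv), mul_add]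

lemma trigConv_smul (a : ℂ) (y : Torus d) :
    trigConv D w (a • u) y = a * trigConv D w u y := by
  simp only [trigConv, trigPoly, Pi.smul_apply, smul_eq_mul, Finset.mul_sum]
  refine Finset.sum_congr rfl fun k _ => ?_
  simp_rw [mul_left_comm _ a]
  rw [integral_const_mul]
  ring

lemma trigConv_sub (hu : Integrable u (torusHaar d)) (hv : Integrable v (torusHaar d))
    (y : Torus d) : trigConv D w (u - v) y = trigConv D w u y - trigConv D w v y := by
  have h : u - v = u + (-1 : ℂ) • v := by
    funext x
    simp [sub_eq_add_neg]
  rw [h, trigConv_add hu (hv.smul _), trigConv_smul]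
  ring

lemma trigConv_torusChar {k : Fin d → ℤ} (hk : k ∈ freqBox d D) (y : Torus d) :
    trigConv D w (torusChar k) y = w k * torusChar k y := by
  simp only [trigConv, trigPoly, ← torusChar.freq_add, integral_torusChar]
  rw [Finset.sum_eq_single k]
  · simp
  · intro k' _ hne
    rw [if_neg]
    · simp
    · intro h0
      exact hne (neg_add_eq_zero.mp h0)
  · exact fun h => absurd hk h

lemma integrable_trigPoly_div_mul {𝕜 : Type*} [RCLike 𝕜] {F : Torus d → 𝕜} (hF : Continuous F)
    {u : Torus d → 𝕜} (hu : Integrable u (torusHaar d)) :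
    Integrable (fun z : Torus d × Torus d => F (z.1 / z.2) * u z.2)
      ((torusHaar d).prod (torusHaar d)) := by
  obtain ⟨C, hC⟩ := isCompact_univ.exists_bound_of_continuousOn hF.continuousOn
  exact (hu.comp_snd _).bdd_mul
    (hF.comp (continuous_fst.div' continuous_snd)).aestronglyMeasurable
    (ae_of_all _ fun z => hC _ (Set.mem_univ _))

end TrigConv

section Kernel

variable {d D : ℕ} {w : (Fin d → ℤ) → ℂ} {u : Torus d → ℂ}

lemma trigPoly_re_nonneg (hpos : ∀ x, 0 ≤ trigPoly D w x) (x : Torus d) :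
    0 ≤ (trigPoly D w x).re :=
  (Complex.nonneg_iff.mp (hpos x)).1

lemma trigPoly_eq_ofReal (hpos : ∀ x, 0 ≤ trigPoly D w x) (x : Torus d) :
    trigPoly D w x = ((trigPoly D w x).re : ℂ) :=
  Complex.ext (by simp) (by simpa using (Complex.nonneg_iff.mp (hpos x)).2.symm)

lemma continuous_re_trigPoly (D : ℕ) (w : (Fin d → ℤ) → ℂ) :
    Continuous fun x => (trigPoly D w x).re :=
  Complex.continuous_re.comp (continuous_trigPoly D w)

lemma integral_re_trigPoly_div_left (h0 : w 0 = 1) (x : Torus d) :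
    ∫ y, (trigPoly D w (y / x)).re ∂(torusHaar d) = 1 := by
  have hc : Continuous fun y => trigPoly D w (y / x) :=
    (continuous_trigPoly D w).comp (continuous_id.div' continuous_const)
  have := integral_re hc.integrable_torusHaar
  simp only [RCLike.re_eq_complex_re] at this
  rw [this, integral_trigPoly_div_left, h0, Complex.one_re]

lemma integral_re_trigPoly_div_right (h0 : w 0 = 1) (y : Torus d) :
    ∫ x, (trigPoly D w (y / x)).re ∂(torusHaar d) = 1 := by
  have hc : Continuous fun x => trigPoly D w (y / x) :=
    (continuous_trigPoly D w).comp (continuous_const.div' continuous_id)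
  have := integral_re hc.integrable_torusHaar
  simp only [RCLike.re_eq_complex_re] at this
  rw [this, integral_trigPoly_div_right, h0, Complex.one_re]

/-- Averaging out the kernel variable: convolution preserves integrals. -/
lemma integral_integral_re_trigPoly_div_mul (h0 : w 0 = 1) {f : Torus d → ℝ}
    (hf : Integrable f (torusHaar d)) :
    ∫ y, ∫ x, (trigPoly D w (y / x)).re * f x ∂(torusHaar d) ∂(torusHaar d) =
      ∫ x, f x ∂(torusHaar d) := by
  rw [integral_integral_swap (integrable_trigPoly_div_mul (continuous_re_trigPoly D w) hf)]
  simp_rw [integral_mul_const, integral_re_trigPoly_div_left h0, one_mul]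

lemma integral_norm_trigConv_le (hpos : ∀ x, 0 ≤ trigPoly D w x) (h0 : w 0 = 1)
    (hu : Integrable u (torusHaar d)) :
    ∫ y, ‖trigConv D w u y‖ ∂(torusHaar d) ≤ ∫ x, ‖u x‖ ∂(torusHaar d) := by
  rw [← integral_integral_re_trigPoly_div_mul (D := D) h0 hu.norm]
  refine integral_mono (continuous_trigConv D w u).norm.integrable_torusHaar
    (integrable_trigPoly_div_mul (continuous_re_trigPoly D w) hu.norm).integral_prod_left
    fun y => ?_
  simp only
  rw [trigConv_eq_integral hu]
  refine (norm_integral_le_integral_norm _).trans_eq (integral_congr_ae (ae_of_all _ fun x => ?_))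
  simp only
  rw [norm_mul, trigPoly_eq_ofReal hpos, Complex.norm_real, Real.norm_of_nonneg
    (trigPoly_re_nonneg hpos _), Complex.ofReal_re]

lemma trigConv_ofReal_re (hpos : ∀ x, 0 ≤ trigPoly D w x) {g : Torus d → ℝ}
    (hg : Integrable g (torusHaar d)) (y : Torus d) :
    (trigConv D w (fun x => (g x : ℂ)) y).re =
      ∫ x, (trigPoly D w (y / x)).re * g x ∂(torusHaar d) := by
  have hgC : Integrable (fun x => (g x : ℂ)) (torusHaar d) := hg.ofReal
  rw [trigConv_eq_integral hgC]
  have h : ∀ x, trigPoly D w (y / x) * (g x : ℂ) = (((trigPoly D w (y / x)).re * g x : ℝ) : ℂ) := by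
    intro x
    rw [Complex.ofReal_mul, ← trigPoly_eq_ofReal hpos]
  simp_rw [h]
  rw [integral_complex_ofReal, Complex.ofReal_re]

/-! ### Entropy and convolution -/

/-- The graph of `-t log t` lies below its tangents. -/
lemma Real.negMulLog_le_tangent {s t : ℝ} (hs : 0 ≤ s) (ht : 0 < t) :
    Real.negMulLog s ≤ Real.negMulLog t - (1 + Real.log t) * (s - t) := by
  rcases hs.eq_or_lt with rfl | hs
  · simp only [Real.negMulLog, neg_mul]
    nlinarith
  · have h := Real.log_le_sub_one_of_pos (div_pos ht hs)
    rw [Real.log_div ht.ne' hs.ne'] at h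
    have h2 := mul_le_mul_of_nonneg_left h hs.le
    have h3 : s * (t / s - 1) = t - s := by field_simp
    rw [h3] at h2
    simp only [Real.negMulLog, neg_mul]
    nlinarith

lemma Real.negMulLog_le_one {s : ℝ} (hs : 0 ≤ s) : Real.negMulLog s ≤ 1 := by
  have := Real.negMulLog_le_tangent hs one_pos
  simp at this
  linarith

/-- Jensen's inequality for the concave function `-t log t` and the probability density
`x ↦ trigPoly D w (y / x)`. -/
lemma integral_mul_negMulLog_le (hpos : ∀ x, 0 ≤ trigPoly D w x) (h0 : w 0 = 1)
    {g : Torus d → ℝ} (hg0 : ∀ x, 0 ≤ g x) (hg : Integrable g (torusHaar d))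
    (hent : Integrable (fun x => Real.negMulLog (g x)) (torusHaar d)) (y : Torus d) :
    ∫ x, (trigPoly D w (y / x)).re * Real.negMulLog (g x) ∂(torusHaar d) ≤
      Real.negMulLog (trigConv D w (fun x => (g x : ℂ)) y).re := by
  rw [trigConv_ofReal_re hpos hg]
  have hcont : Continuous fun x => (trigPoly D w (y / x)).re :=
    (continuous_re_trigPoly D w).comp (continuous_const.div' continuous_id)
  have hint : ∀ {f : Torus d → ℝ}, Integrable f (torusHaar d) →
      Integrable (fun x => (trigPoly D w (y / x)).re * f x) (torusHaar d) := by
    intro f hf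
    obtain ⟨C, hC⟩ := isCompact_univ.exists_bound_of_continuousOn hcont.continuousOn
    exact hf.bdd_mul hcont.aestronglyMeasurable (ae_of_all _ fun x => hC x (Set.mem_univ x))
  have hk0 : ∀ x, 0 ≤ (trigPoly D w (y / x)).re * g x := fun x =>
    mul_nonneg (trigPoly_re_nonneg hpos _) (hg0 x)
  set t := ∫ x, (trigPoly D w (y / x)).re * g x ∂(torusHaar d) with ht
  have ht0 : 0 ≤ t := integral_nonneg hk0
  rcases ht0.eq_or_lt with h | h
  · -- A vanishing average forces `g = 0` wherever the kernel is positive.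
    have hae := (integral_eq_zero_iff_of_nonneg hk0 (hint hg)).mp (ht.symm.trans h.symm)
    rw [← h, Real.negMulLog_zero]
    refine (integral_eq_zero_of_ae ?_).le
    filter_upwards [hae] with x hx
    rcases mul_eq_zero.mp hx with hx | hx
    · simp [hx]
    · simp [hx]
  · calc _ ≤ ∫ x, ((trigPoly D w (y / x)).re * (Real.negMulLog t + (1 + Real.log t) * t) -
          (1 + Real.log t) * ((trigPoly D w (y / x)).re * g x)) ∂(torusHaar d) := by
          refine integral_mono (hint hent)
            ((hcont.integrable_torusHaar.mul_const _).sub ((hint hg).const_mul _)) fun x => ?_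
          refine (mul_le_mul_of_nonneg_left (Real.negMulLog_le_tangent (hg0 x) h)
            (trigPoly_re_nonneg hpos _)).trans_eq ?_
          ring
      _ = Real.negMulLog t := by
          rw [integral_sub (hcont.integrable_torusHaar.mul_const _) ((hint hg).const_mul _),
            integral_mul_const, integral_const_mul, integral_re_trigPoly_div_right h0, ← ht]
          ring

/-- Convolution with a probability density does not decrease the differential entropy. -/
lemma integral_negMulLog_le_trigConv (hpos : ∀ x, 0 ≤ trigPoly D w x) (h0 : w 0 = 1)
    {g : Torus d → ℝ} (hg0 : ∀ x, 0 ≤ g x) (hg : Integrable g (torusHaar d))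
    (hent : Integrable (fun x => Real.negMulLog (g x)) (torusHaar d)) :
    ∫ x, Real.negMulLog (g x) ∂(torusHaar d) ≤
      ∫ y, Real.negMulLog (trigConv D w (fun x => (g x : ℂ)) y).re ∂(torusHaar d) := by
  rw [← integral_integral_re_trigPoly_div_mul (D := D) h0 hent]
  exact integral_mono
    (integrable_trigPoly_div_mul (continuous_re_trigPoly D w) hent).integral_prod_left
    (Real.continuous_negMulLog.comp
      (Complex.continuous_re.comp (continuous_trigConv D w _))).integrable_torusHaar
    (integral_mul_negMulLog_le hpos h0 hg0 hg hent)

end Kernel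

section ApproximateIdentity

variable {d : ℕ} {w : ℕ → (Fin d → ℤ) → ℂ}

/-- Convolutions with nonnegative trigonometric kernels of mass one whose Fourier coefficients tend
to one converge in `L¹`: this is clear for characters, and all these convolutions are contractions. -/
lemma tendsto_integral_norm_trigConv_sub (hpos : ∀ N x, 0 ≤ trigPoly N (w N) x)
    (h0 : ∀ N, w N 0 = 1) (h1 : ∀ k, Tendsto (fun N => w N k) atTop (𝓝 1))
    {u : Torus d → ℂ} (hu : Integrable u (torusHaar d)) :
    Tendsto (fun N => ∫ y, ‖trigConv N (w N) u y - u y‖ ∂(torusHaar d)) atTop (𝓝 0) := by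
  have hI : ∀ {v : Torus d → ℂ} (N : ℕ), Integrable v (torusHaar d) →
      Integrable (fun y => trigConv N (w N) v y - v y) (torusHaar d) := fun N hv =>
    (continuous_trigConv N _ _).integrable_torusHaar.sub hv
  have hspan : ∀ p ∈ Submodule.span ℂ (Set.range (torusChar (d := d))), Continuous p ∧
      Tendsto (fun N => ∫ y, ‖trigConv N (w N) p y - p y‖ ∂(torusHaar d)) atTop (𝓝 0) := by
    intro p hp
    induction hp using Submodule.span_induction with
    | mem p hp =>
      obtain ⟨k, rfl⟩ := hp
      refine ⟨torusChar.continuous k, ?_⟩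
      have hlim : Tendsto (fun N => ‖w N k - 1‖) atTop (𝓝 0) := by
        simpa using ((h1 k).sub_const 1).norm
      refine hlim.congr' ?_
      filter_upwards [eventually_ge_atTop (∑ l, (k l).natAbs)] with N hN
      have hk : k ∈ freqBox d N := mem_freqBox.mpr fun l => by
        have : (k l).natAbs ≤ ∑ l, (k l).natAbs :=
          Finset.single_le_sum (f := fun l => (k l).natAbs) (fun _ _ => Nat.zero_le _)
            (Finset.mem_univ l)
        rw [Int.abs_eq_natAbs]
        exact_mod_cast this.trans hN
      simp_rw [trigConv_torusChar hk, ← sub_one_mul, norm_mul, torusChar.norm_eq_one]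
      simp
    | zero =>
      refine ⟨continuous_const, ?_⟩
      have : ∀ N y, trigConv N (w N) (0 : Torus d → ℂ) y = 0 := fun N y => by
        simp [trigConv, trigPoly]
      simp [this]
    | add f g _ _ hf hg =>
      refine ⟨hf.1.add hg.1, ?_⟩
      have hfi := hf.1.integrable_torusHaar
      have hgi := hg.1.integrable_torusHaar
      refine squeeze_zero (fun N => integral_nonneg fun y => norm_nonneg _) (fun N => ?_)
        (by simpa using hf.2.add hg.2)
      rw [← integral_add (hI N hfi).norm (hI N hgi).norm]
      refine integral_mono (hI N (hfi.add hgi)).norm ((hI N hfi).norm.add (hI N hgi).norm)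
        fun y => ?_
      simp only [Pi.add_apply]
      rw [trigConv_add hfi hgi, add_sub_add_comm]
      exact norm_add_le _ _
    | smul a f _ hf =>
      refine ⟨hf.1.const_smul a, ?_⟩
      simp_rw [trigConv_smul, Pi.smul_apply, smul_eq_mul, ← mul_sub, norm_mul, integral_const_mul]
      simpa using hf.2.const_mul ‖a‖
  rw [Metric.tendsto_atTop']
  intro ε hε
  obtain ⟨f, hf, hfi⟩ := hu.exists_boundedContinuous_integral_sub_le (show 0 < ε / 8 by positivity)
  obtain ⟨p, hp, hfp⟩ := exists_span_torusChar_near f.continuous (show 0 < ε / 8 by positivity)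
  obtain ⟨hpc, hpt⟩ := hspan p hp
  have hpi := hpc.integrable_torusHaar
  have hup : ∫ x, ‖(u - p) x‖ ∂(torusHaar d) ≤ ε / 4 := by
    calc _ ≤ ∫ x, (‖u x - f x‖ + ε / 8) ∂(torusHaar d) := by
          refine integral_mono (hu.sub hpi).norm ((hu.sub hfi).norm.add (integrable_const _))
            fun x => ?_
          exact (norm_sub_le_norm_sub_add_norm_sub (u x) (f x) (p x)).trans
            (add_le_add le_rfl (hfp x))
      _ ≤ ε / 4 := by
          have hufi : Integrable (fun x => ‖u x - f x‖) (torusHaar d) := (hu.sub hfi).norm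
          rw [integral_add hufi (integrable_const _)]
          simp only [integral_const, probReal_univ, one_smul]
          linarith
  obtain ⟨N₀, hN₀⟩ := Metric.tendsto_atTop'.mp hpt (ε / 4) (by positivity)
  refine ⟨N₀, fun N hN => ?_⟩
  have h2 := hN₀ N hN
  rw [Real.dist_0_eq_abs, abs_of_nonneg (integral_nonneg fun y => norm_nonneg _)] at h2 ⊢
  have hsubi := hu.sub hpi
  calc _ ≤ ∫ y, (‖trigConv N (w N) (u - p) y‖ + ‖trigConv N (w N) p y - p y‖ + ‖(u - p) y‖)
        ∂(torusHaar d) := by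
        refine integral_mono (hI N hu).norm
          (((continuous_trigConv N _ _).norm.integrable_torusHaar.add (hI N hpi).norm).add
            hsubi.norm) fun y => ?_
        simp only
        rw [trigConv_sub hu hpi, Pi.sub_apply, ← norm_neg (u y - p y)]
        refine le_trans (le_of_eq ?_) (norm_add₃_le)
        congr 1
        ring
    _ = ∫ y, ‖trigConv N (w N) (u - p) y‖ ∂(torusHaar d) +
        ∫ y, ‖trigConv N (w N) p y - p y‖ ∂(torusHaar d) + ∫ y, ‖(u - p) y‖ ∂(torusHaar d) := by
        have hadd : Integrable (fun y => ‖trigConv N (w N) (u - p) y‖ +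
            ‖trigConv N (w N) p y - p y‖) (torusHaar d) :=
          (continuous_trigConv N _ _).norm.integrable_torusHaar.add (hI N hpi).norm
        rw [integral_add hadd hsubi.norm,
          integral_add (continuous_trigConv N _ _).norm.integrable_torusHaar (hI N hpi).norm]
    _ < ε := by
        have := integral_norm_trigConv_le (hpos N) (h0 N) hsubi
        linarith

/-- Along an approximate identity the differential entropy converges: it is bounded below by
concavity and above by Fatou's lemma. -/
lemma tendsto_integral_negMulLog_trigConv (hpos : ∀ N x, 0 ≤ trigPoly N (w N) x)
    (h0 : ∀ N, w N 0 = 1) (h1 : ∀ k, Tendsto (fun N => w N k) atTop (𝓝 1))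
    {g : Torus d → ℝ} (hg0 : ∀ x, 0 ≤ g x) (hg : Integrable g (torusHaar d))
    (hent : Integrable (fun x => Real.negMulLog (g x)) (torusHaar d)) :
    Tendsto (fun N => ∫ y, Real.negMulLog (trigConv N (w N) (fun x => (g x : ℂ)) y).re
      ∂(torusHaar d)) atTop (𝓝 (∫ x, Real.negMulLog (g x) ∂(torusHaar d))) := by
  set G : ℕ → Torus d → ℝ := fun N y => (trigConv N (w N) (fun x => (g x : ℂ)) y).re with hG
  have hGc : ∀ N, Continuous (G N) := fun N =>
    Complex.continuous_re.comp (continuous_trigConv N _ _)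
  have hG0 : ∀ N y, 0 ≤ G N y := fun N y => by
    simp only [hG]
    rw [trigConv_ofReal_re (hpos N) hg]
    exact integral_nonneg fun x => mul_nonneg (trigPoly_re_nonneg (hpos N) _) (hg0 x)
  have hGe : ∀ N, Integrable (fun y => Real.negMulLog (G N y)) (torusHaar d) := fun N =>
    (Real.continuous_negMulLog.comp (hGc N)).integrable_torusHaar
  have hL1 : Tendsto (fun N => eLpNorm (G N - g) 1 (torusHaar d)) atTop (𝓝 0) := by
    have hgC : Integrable (fun x => (g x : ℂ)) (torusHaar d) := hg.ofReal
    have h := tendsto_integral_norm_trigConv_sub hpos h0 h1 hgC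
    have h' := (ENNReal.continuous_ofReal.tendsto _).comp h
    rw [ENNReal.ofReal_zero] at h'
    refine tendsto_of_tendsto_of_tendsto_of_le_of_le tendsto_const_nhds h' (fun _ => zero_le)
      fun N => ?_
    simp only [Function.comp_apply]
    have hsub : Integrable (fun y => trigConv N (w N) (fun x => (g x : ℂ)) y - (g y : ℂ))
        (torusHaar d) := (continuous_trigConv N _ _).integrable_torusHaar.sub hgC
    rw [ofReal_integral_norm_eq_lintegral_enorm hsub,
      eLpNorm_one_eq_lintegral_enorm]
    refine lintegral_mono fun y => ?_
    rw [enorm_le_iff_norm_le]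
    have := Complex.abs_re_le_norm (trigConv N (w N) (fun x => (g x : ℂ)) y - (g y : ℂ))
    simpa using this
  have hstep : ∀ f : Torus d → ℝ, (∀ x, 0 ≤ f x) →
      Integrable (fun x => Real.negMulLog (f x)) (torusHaar d) →
      ∫⁻ x, ENNReal.ofReal (1 - Real.negMulLog (f x)) ∂(torusHaar d) =
        ENNReal.ofReal (1 - ∫ x, Real.negMulLog (f x) ∂(torusHaar d)) := by
    intro f hf0 hf
    have hsub : Integrable (fun x => 1 - Real.negMulLog (f x)) (torusHaar d) :=
      (integrable_const 1).sub hf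
    rw [← ofReal_integral_eq_lintegral_ofReal hsub
      (ae_of_all _ fun x => sub_nonneg.mpr (Real.negMulLog_le_one (hf0 x))),
      integral_sub (integrable_const 1) hf]
    simp
  refine tendsto_of_subseq_tendsto fun ns hns => ?_
  obtain ⟨ms, hms, hae⟩ := (tendstoInMeasure_of_tendsto_eLpNorm one_ne_zero
    (fun N => (hGc (ns N)).aestronglyMeasurable) hg.aestronglyMeasurable
    (hL1.comp hns)).exists_seq_tendsto_ae
  refine ⟨ms, ?_⟩
  have hfatou : ENNReal.ofReal (1 - ∫ x, Real.negMulLog (g x) ∂(torusHaar d)) ≤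
      liminf (fun i => ENNReal.ofReal (1 - ∫ x, Real.negMulLog (G (ns (ms i)) x)
        ∂(torusHaar d))) atTop := by
    rw [← hstep g hg0 hent]
    simp_rw [← fun i => hstep (G (ns (ms i))) (hG0 _) (hGe _)]
    refine le_trans (lintegral_mono_ae ?_) (lintegral_liminf_le fun i => ?_)
    · filter_upwards [hae] with x hx
      refine le_of_eq (Tendsto.liminf_eq ?_).symm
      exact (ENNReal.continuous_ofReal.tendsto _).comp
        (((Real.continuous_negMulLog.tendsto _).comp hx).const_sub 1)
    · exact (ENNReal.continuous_ofReal.comp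
        (continuous_const.sub (Real.continuous_negMulLog.comp (hGc _)))).measurable
  have hle : ∀ N, ∫ x, Real.negMulLog (g x) ∂(torusHaar d) ≤
      ∫ x, Real.negMulLog (G N x) ∂(torusHaar d) := fun N =>
    integral_negMulLog_le_trigConv (hpos N) (h0 N) hg0 hg hent
  have hlim : Tendsto (fun i => ENNReal.ofReal (1 - ∫ x, Real.negMulLog (G (ns (ms i)) x)
        ∂(torusHaar d))) atTop
      (𝓝 (ENNReal.ofReal (1 - ∫ x, Real.negMulLog (g x) ∂(torusHaar d)))) :=
    tendsto_of_le_liminf_of_limsup_le hfatou (limsup_le_of_le (h := Eventually.of_forall fun i =>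
      ENNReal.ofReal_le_ofReal (by linarith [hle (ns (ms i))])))
  have hnonneg : ∀ f : Torus d → ℝ, (∀ x, 0 ≤ f x) →
      Integrable (fun x => Real.negMulLog (f x)) (torusHaar d) →
      0 ≤ 1 - ∫ x, Real.negMulLog (f x) ∂(torusHaar d) := by
    intro f hf0 hf
    have := integral_mono hf (integrable_const 1) fun x => Real.negMulLog_le_one (hf0 x)
    simpa using this
  have hreal := (ENNReal.tendsto_toReal ENNReal.ofReal_ne_top).comp hlim
  rw [ENNReal.toReal_ofReal (hnonneg g hg0 hent)] at hreal
  simp only [Function.comp_def] at hreal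
  simp_rw [fun i => ENNReal.toReal_ofReal (hnonneg (G (ns (ms i))) (hG0 _) (hGe _))] at hreal
  simpa using hreal.const_sub 1

end ApproximateIdentity

/-! ### Smoothed random variables -/

/-- The Fourier coefficients of the density of the product of `X` with an independent random
variable whose density is the `N`-th Fejér kernel. -/
noncomputable def smoothedCoeff {Ω : Type*} [MeasurableSpace Ω] {d : ℕ} (P : Measure Ω)
    (X : Ω → Torus d) (N : ℕ) (k : Fin d → ℤ) : ℂ :=
  fejerCoeff N k * ∫ ω, torusChar (-k) (X ω) ∂P

section Smoothing

variable {Ω : Type*} [MeasurableSpace Ω] {P : Measure Ω} {d m : ℕ}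

lemma smoothedCoeff_zero [IsProbabilityMeasure P] (X : Ω → Torus d) (N : ℕ) :
    smoothedCoeff P X N 0 = 1 := by
  simp [smoothedCoeff, fejerCoeff_zero, torusChar.freq_zero]

lemma smoothedCoeff_eq_zero (X : Ω → Torus d) {N : ℕ} {k : Fin d → ℤ} (hk : k ∉ freqBox d N) :
    smoothedCoeff P X N k = 0 := by
  rw [smoothedCoeff, fejerCoeff_eq_zero hk, zero_mul]

lemma integrable_torusChar_comp [IsProbabilityMeasure P] {X : Ω → Torus d}
    (hX : Measurable X) (k : Fin d → ℤ) :
    Integrable (fun ω => torusChar k (X ω)) P :=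
  Integrable.of_bound ((torusChar.continuous k).measurable.comp hX).aestronglyMeasurable 1
    (ae_of_all _ fun _ => (torusChar.norm_eq_one k _).le)

lemma trigPoly_smoothedCoeff_nonneg [IsProbabilityMeasure P] {X : Ω → Torus d}
    (hX : Measurable X) (N : ℕ) (x : Torus d) :
    0 ≤ trigPoly N (smoothedCoeff P X N) x := by
  have h : trigPoly N (smoothedCoeff P X N) x =
      ∫ ω, trigPoly N (fejerCoeff N) (x / X ω) ∂P := by
    unfold trigPoly
    rw [integral_finsetSum]
    · refine Finset.sum_congr rfl fun k _ => ?_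
      simp_rw [torusChar.map_div, ← mul_assoc, integral_const_mul, smoothedCoeff]
      ring
    · intro k _
      simp_rw [torusChar.map_div]
      exact ((integrable_torusChar_comp hX _).const_mul _).const_mul _
  rw [h]
  rw [integral_congr_ae (ae_of_all _ fun ω =>
    trigPoly_eq_ofReal (trigPoly_fejerCoeff_nonneg N) (x / X ω)), integral_complex_ofReal]
  exact_mod_cast integral_nonneg fun ω => trigPoly_re_nonneg (trigPoly_fejerCoeff_nonneg N) _

lemma measurable_prod_zpow {X : Fin m → Ω → Torus d} (hX : ∀ j, Measurable (X j))
    (a : Fin m → ℤ) : Measurable fun ω => ∏ j, X j ω ^ a j := by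
  have : Continuous fun z : Fin m → Torus d => ∏ j, z j ^ a j := by fun_prop
  exact this.measurable.comp (measurable_pi_lambda _ hX)

/-- Smoothing the independent `Xⱼ` smooths `∏ⱼ Xⱼ ^ aⱼ`. -/
lemma combCoeff_smoothedCoeff {X : Fin m → Ω → Torus d} (hX : ∀ j, Measurable (X j))
    (hindep : iIndepFun X P) (a : Fin m → ℤ) (N : ℕ) (k : Fin d → ℤ) :
    combCoeff a (fun j => smoothedCoeff P (X j) N) k =
      combCoeff a (fun _ => fejerCoeff N) k * ∫ ω, torusChar (-k) (∏ j, X j ω ^ a j) ∂P := by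
  simp only [combCoeff, smoothedCoeff, Finset.prod_mul_distrib]
  congr 1
  simp_rw [torusChar.map_prod, torusChar.map_zpow, smul_neg]
  exact (hindep.integral_fun_prod_comp (f := fun j => torusChar (-(a j • k)))
    (fun j => (hX j).aemeasurable)
    fun j => (torusChar.continuous _).aestronglyMeasurable).symm

lemma integral_torusChar_comp_eq_integral_mul_density [IsProbabilityMeasure P]
    {Y : Ω → Torus d} (hY : Measurable Y)
    (hac : P.map Y ≪ torusHaar d) (k : Fin d → ℤ) :
    ∫ ω, torusChar k (Y ω) ∂P =
      ∫ x, torusChar k x * (density P (torusHaar d) Y x : ℂ) ∂(torusHaar d) := by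
  have : IsProbabilityMeasure (P.map Y) := Measure.isProbabilityMeasure_map hY.aemeasurable
  rw [← integral_map hY.aemeasurable (torusChar.continuous k).aestronglyMeasurable,
    ← integral_rnDeriv_smul hac]
  refine integral_congr_ae (ae_of_all _ fun x => ?_)
  simp only [density, Complex.real_smul, mul_comm]

lemma trigPoly_combCoeff_smoothedCoeff [IsProbabilityMeasure P] {X : Fin m → Ω → Torus d}
    (hX : ∀ j, Measurable (X j))
    (hindep : iIndepFun X P) (a : Fin m → ℤ)
    (hac : P.map (fun ω => ∏ j, X j ω ^ a j) ≪ torusHaar d) (N : ℕ) :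
    trigPoly N (combCoeff a fun j => smoothedCoeff P (X j) N) =
      trigConv N (combCoeff a fun _ => fejerCoeff N)
        (fun x => (density P (torusHaar d) (fun ω => ∏ j, X j ω ^ a j) x : ℂ)) := by
  funext y
  unfold trigConv trigPoly
  refine Finset.sum_congr rfl fun k _ => ?_
  rw [combCoeff_smoothedCoeff hX hindep,
    integral_torusChar_comp_eq_integral_mul_density (measurable_prod_zpow hX a) hac]

end Smoothing

theorem theorem4 {n m : ℕ} (a : Fin n → Fin m → ℤ) (α : Fin n → ℝ)
    (ha : ∀ i, Finset.univ.gcd (a i) = 1)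
    (hα : ∑ i, α i = 0)
    (hdisc : ∀ (G : Type) [AddCommGroup G] [IsAddCyclic G] [Fintype G]
      [MeasurableSpace G] [DiscreteMeasurableSpace G]
      (Ω : Type) [MeasurableSpace Ω] (P : Measure Ω) [IsProbabilityMeasure P]
      (Z : Fin m → Ω → G), (∀ j, Measurable (Z j)) → iIndepFun Z P →
      ∑ i, α i * shannonEntropy P (fun ω => ∑ j, a i j • Z j ω) ≤ 0)
    {d : ℕ} {Ω : Type*} [MeasurableSpace Ω] (P : Measure Ω) [IsProbabilityMeasure P]
    (X : Fin m → Ω → Torus d) (hX : ∀ j, Measurable (X j)) (hindep : iIndepFun X P)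
    (hcont : ∀ j, P.map (X j) ≪ torusHaar d)
    (hfin : ∀ i, FiniteDiffEntropy P (torusHaar d) (fun ω => ∏ j, X j ω ^ a i j)) :
    ∑ i, α i * diffEntropy P (torusHaar d) (fun ω => ∏ j, X j ω ^ a i j) ≤ 0 := by
  have hineq : CyclicEntropyIneq a α := hdisc
  have hbez : ∀ i, ∃ b : Fin m → ℤ, ∑ j, a i j * b j = 1 := fun i => by
    obtain ⟨b, hb⟩ := Finset.gcd_eq_sum_mul Finset.univ (a i)
    exact ⟨b, hb.symm.trans (ha i)⟩
  choose b hab using hbez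
  refine le_of_tendsto' (tendsto_finsetSum Finset.univ fun i _ =>
    (tendsto_integral_negMulLog_trigConv (w := fun N => combCoeff (a i) fun _ => fejerCoeff N)
      (fun N => trigPoly_combCoeff_nonneg (hab i) (fun _ _ hk => fejerCoeff_eq_zero hk)
        fun _ => trigPoly_fejerCoeff_nonneg N)
      (fun N => by simp [combCoeff, fejerCoeff_zero])
      (fun k => by
        simpa [combCoeff] using tendsto_finsetProd Finset.univ
          fun j _ => tendsto_fejerCoeff (a i j • k))
      (fun x => ENNReal.toReal_nonneg) Measure.integrable_toReal_rnDeriv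
      (hfin i).2).const_mul (α i)) fun N => ?_
  have key := hineq.integral_le hα (d := d) hab
    (c := fun j => smoothedCoeff P (X j) N) (fun j _ hk => smoothedCoeff_eq_zero (X j) hk)
    (fun j => trigPoly_smoothedCoeff_nonneg (hX j) N) (fun j => smoothedCoeff_zero (X j) N)
  simp_rw [fun i => trigPoly_combCoeff_smoothedCoeff hX hindep (a i) (hfin i).1 N] at key
  exact key
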